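/- For $\mu>0$ put $\omega(\xi)=\sqrt{\tanh(\xi)/\xi}$ ($\omega(0)=1$), and for $u\in L^1(\mathbb{R})$ let $\widehat{u}(\xi)=\frac{1}{2\pi}\int_{\mathbb{R}}e^{-iX\xi}u(X)\,dX$. Let $|u|_{H^3}=|(1+|D|^2)^{3/2}u|_{L^2}$ with $D=-i\partial_X$, and let $|\cdot|_\infty$ be the $L^\infty(\mathbb{R})$ norm in $X$. Let $\mu_{\max}>0$. Let $P_0\in H^3(\mathbb{R})\cap W^{2,1}(\mathbb{R})$ (possibly complex valued) be such that $XP_0\in H^3(\mathbb{R})$, and for $0<\mu\le\mu_{\max}$ and $t\ge 0$ let $$\zeta_R(t,X)=-\frac{it}{2}\int_{\mathbb{R}}\xi\,\omega(\sqrt{\mu}\,\xi)\,\widehat{P_0}(\xi)\,e^{-it\xi\omega(\sqrt{\mu}\xi)}e^{iX\xi}\,d\xi .$$ (0) The integral converges absolutely, and $\zeta_R$ is the right-going amplitude generated by the resonant pressure $\widehat{P}(t,\xi)=e^{-it\xi\omega(\sqrt{\mu}\xi)}\widehat{P_0}(\xi)$, that is, $$\zeta_R(t,X)=\int_{\mathbb{R}}\Big(-\frac{i}{2}\int_0^t\xi\,\omega(\sqrt\mu\,\xi)\,\widehat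 P(\tau,\xi)\,e^{i(\tau-t)\xi\omega(\sqrt\mu\xi)}\,d\tau\Big)e^{iX\xi}\,d\xi .$$ (1) There is a constant $C=C(\mu_{\max})>0$, independent of $P_0$, $\mu$ and $t$, such that for all such $P_0$, all $0<\mu\le\mu_{\max}$ and all $t\ge 0$, $$|\zeta_R(t,\cdot)|_\infty\le C\sqrt{\frac{t}{\mu}}\,\big(|P_0|_{H^3}+|P_0|_{L^1}+|XP_0|_{H^3}\big).$$ (2) If moreover $P_0$ is not almost everywhere zero, then there is a constant $c>0$, depending only on $P_0$ and $\mu_{\max}$, such that for all $0<\mu\le\mu_{\max}$, $$\liminf_{t\to+\infty}\Big|\frac{1}{\sqrt t}\,\zeta_R(t,\cdot)\Big|_\infty\ge c>0 .$$ In particular the amplification is exactly of order $\sqrt t$. -/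

import Mathlib

open MeasureTheory Filter
open scoped ENNReal SchwartzMap FourierTransform

noncomputable section

/-- The classical Sobolev space `W^{k,p}(ℝ)`: the (distributional) derivatives of order at most `k`
of `u` are `L^p` functions. -/
def MemW (k : ℕ) (p : ℝ≥0∞) [Fact (1 ≤ p)] (u : ℝ → ℂ) : Prop :=
  ∃ h : MemLp u p volume, ∀ j ≤ k, ∃ g : Lp ℂ p (volume : Measure ℝ),
    (TemperedDistribution.derivCLM ℂ)^[j] (h.toLp u : 𝓢'(ℝ, ℂ)) = (g : 𝓢'(ℝ, ℂ))

/-- The space `H^s(ℝ)`, for `s ≥ 0`: functions in `L²` whose associated tempered distribution is a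
Sobolev distribution of order `s` and exponent `2`. -/
def MemH (s : ℝ) (u : ℝ → ℂ) : Prop :=
  ∃ h : MemLp u 2 volume, TemperedDistribution.MemSobolev s 2 (h.toLp u : 𝓢'(ℝ, ℂ))

open Classical in
/-- The norm `|u|_{H^s} = |(1 + |D|²)^{s/2} u|_{L²}` with `D = -i ∂_X`, computed on the Fourier side:
in Mathlib's normalization of the Fourier transform, `D` is multiplication by `2 π ξ`, and the
transform is an isometry of `L²`. The value is `∞` if `u` is not in `L²`. -/
def hNorm (s : ℝ) (u : ℝ → ℂ) : ℝ≥0∞ :=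
  if h : MemLp u 2 volume then
    eLpNorm (fun ξ : ℝ ↦ (((1 + (2 * Real.pi * ξ) ^ 2) ^ (s / 2) : ℝ) : ℂ) *
      (𝓕 (h.toLp u) : Lp ℂ 2 (volume : Measure ℝ)) ξ) 2 volume
  else ∞

/-- The `H^s` norm of an element of `H^s` is finite. -/
theorem MemH.hNorm_lt_top {s : ℝ} (hs : 0 ≤ s) {u : ℝ → ℂ} (hu : MemH s u) : hNorm s u < ∞ := by
  obtain ⟨h, hS⟩ := hu
  obtain ⟨f', hf'⟩ := TemperedDistribution.memSobolev_iff_exists_smulLeftCLM_fourier.mp hS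
  rw [Lp.fourier_toTemperedDistribution_eq] at hf'
  rw [hNorm, dif_pos h]
  set v : Lp ℂ 2 (volume : Measure ℝ) := 𝓕 (h.toLp u) with hv
  have hcw : Continuous fun x : ℝ ↦ (((1 + ‖x‖ ^ 2) ^ (s / 2) : ℝ) : ℂ) := by
    refine Complex.continuous_ofReal.comp ?_
    refine Continuous.rpow_const (by fun_prop) fun x ↦ Or.inl ?_
    positivity
  have hlv : LocallyIntegrable (v : ℝ → ℂ) volume := (Lp.memLp v).locallyIntegrable one_le_two
  have key : ∀ᵐ x : ℝ, (((1 + ‖x‖ ^ 2) ^ (s / 2) : ℝ) : ℂ) * v x = f' x := by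
    apply ae_eq_of_integral_contDiff_smul_eq
    · rw [← locallyIntegrableOn_univ]
      exact (hlv.locallyIntegrableOn Set.univ).continuousOn_mul hcw.continuousOn
        isOpen_univ.isLocallyClosed
    · exact (Lp.memLp f').locallyIntegrable one_le_two
    · intro g g_smooth g_cpt
      have hg₁ : HasCompactSupport (Complex.ofRealCLM ∘ g) := g_cpt.comp_left rfl
      have hg₂ : ContDiff ℝ (⊤ : ℕ∞) (Complex.ofRealCLM ∘ g) := by fun_prop
      have e := congrArg (fun T : 𝓢'(ℝ, ℂ) ↦ T (hg₁.toSchwartzMap hg₂)) hf'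
      simp only [TemperedDistribution.smulLeftCLM_apply_apply,
        Lp.toTemperedDistribution_apply] at e
      rw [show (∫ x, g x • f' x) = ∫ x, (hg₁.toSchwartzMap hg₂) x • f' x by simp, ← e]
      refine integral_congr_ae (Eventually.of_forall fun x ↦ ?_)
      simp only
      rw [SchwartzMap.smulLeftCLM_apply_apply (by fun_prop)]
      simp
      ring
  have hmem : MemLp (fun ξ : ℝ ↦ ((((2 * Real.pi) ^ 2) ^ (s / 2) : ℝ) : ℂ) * f' ξ) 2 volume :=
    (Lp.memLp f').const_mul _
  refine lt_of_le_of_lt (eLpNorm_mono_ae ?_) hmem.2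
  filter_upwards [key] with x hx
  rw [← hx, ← mul_assoc, norm_mul, norm_mul (_ * _)]
  refine mul_le_mul_of_nonneg_right ?_ (norm_nonneg _)
  rw [← Complex.ofReal_mul, ← Real.mul_rpow (by positivity) (by positivity)]
  simp only [Complex.norm_real, Real.norm_eq_abs]
  rw [abs_of_nonneg (by positivity), abs_of_nonneg (by positivity)]
  refine Real.rpow_le_rpow (by positivity) ?_ (by positivity)
  have : 1 ≤ 2 * Real.pi := by linarith [Real.pi_gt_three]
  rw [sq_abs]
  nlinarith

/-- The Fourier transform `û(ξ) = (2π)⁻¹ ∫ e^{-iXξ} u(X) dX`, for which the inversion formula reads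
`u(X) = ∫ û(ξ) e^{iXξ} dξ`. -/
def hat (u : ℝ → ℂ) (ξ : ℝ) : ℂ :=
  ((2 * Real.pi : ℝ) : ℂ)⁻¹ * ∫ X : ℝ, Complex.exp (-(Complex.I * X * ξ)) * u X

/-- `ω(ξ) = √(tanh ξ / ξ)`, extended by continuity at `0`. -/
def waveOmega (ξ : ℝ) : ℝ :=
  if ξ = 0 then 1 else Real.sqrt (Real.tanh ξ / ξ)

/-- The dispersion relation `ξ ω(√μ ξ)` of the linear water waves equations. -/
def disp (μ ξ : ℝ) : ℝ := ξ * waveOmega (Real.sqrt μ * ξ)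

/-- The resonant pressure, on the Fourier side: `P̂(t, ξ) = e^{-i t ξ ω(√μ ξ)} P̂₀(ξ)`. -/
def resonantPressureHat (μ : ℝ) (P₀ : ℝ → ℂ) (t ξ : ℝ) : ℂ :=
  Complex.exp (-(Complex.I * t * disp μ ξ)) * hat P₀ ξ

/-- The Fourier transform of the right-going part of the solution, initially at rest, of the linear
water waves equations with surface pressure `P`, as a function of `P̂`. -/
def rightGoingHat (μ : ℝ) (Phat : ℝ → ℝ → ℂ) (t ξ : ℝ) : ℂ :=
  -(Complex.I / 2) * ∫ τ in (0 : ℝ)..t,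
    (disp μ ξ : ℂ) * Phat τ ξ * Complex.exp (Complex.I * (τ - t) * disp μ ξ)

/-- The integrand in the formula for `ζ_R`. -/
def zetaIntegrand (μ : ℝ) (P₀ : ℝ → ℂ) (t X ξ : ℝ) : ℂ :=
  (disp μ ξ : ℂ) * hat P₀ ξ * Complex.exp (-(Complex.I * t * disp μ ξ)) *
    Complex.exp (Complex.I * X * ξ)

/-- `ζ_R(t,X) = -(i t / 2) ∫ ξ ω(√μ ξ) P̂₀(ξ) e^{-i t ξ ω(√μ ξ)} e^{i X ξ} dξ`. -/
def zetaR (μ : ℝ) (P₀ : ℝ → ℂ) (t X : ℝ) : ℂ :=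
  -(Complex.I * t / 2) * ∫ ξ : ℝ, zetaIntegrand μ P₀ t X ξ

end

/-! Write φ = `disp μ`. At resonance the Duhamel integrand does not depend on τ, which produces the
prefactor t; dispersion then takes back a factor √t and no more.

Upper bound. Dividing the multiplier by 1 + ξ² exhibits `zetaR` as -(it/2) times the convolution, up
to 2π, of P₀ - P₀'' with the kernel ∫ φ(ξ)/(1+ξ²) e^{i(Xξ - tφ(ξ))} dξ. For ξ > 0 the phase is
convex, with second derivative at least t μ ξ / (32 (1+√μ ξ)³) (`le_dispersion`). This degenerates
at 0 and at infinity, so van der Corput's lemma is needed with a variable weight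
(`norm_integral_mul_cexp_le`). It bounds the kernel by a multiple of (1+√μ)/(√μ √t), uniformly in X
(`norm_integral_kernelIntegrand_le`). The L¹ norm of P₀'' is at most a constant times |P₀''|₂ + |X
P₀''|₂, and X P₀'' = (X P₀)'' - 2 P₀' (`exists_eLpNorm_one_weakDeriv_le`).

Lower bound, by L^∞–L¹ duality. Pair `zetaR` with the wave packet whose transform is β(ξ)
e^{itφ(ξ)}, β being a cutoff away from 0. The oscillations cancel, and the pairing is t/2 times a
quantity bounded below uniformly in μ (`exists_le_norm_integral_disp_mul_hat`). As |φ'| ≤ 1, the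
packet has L¹ norm at most M√t (`exists_schwartz_wave_packet`). The quotient is of order √t. -/

/-! ### Elementary bounds for the hyperbolic tangent. -/

theorem hasDerivAt_tanh (x : ℝ) : HasDerivAt Real.tanh (1 - Real.tanh x ^ 2) x := by
  have h := (Real.hasDerivAt_sinh x).div (Real.hasDerivAt_cosh x) (Real.cosh_pos x).ne'
  have e : Real.tanh = Real.sinh / Real.cosh := by
    ext y
    exact Real.tanh_eq_sinh_div_cosh y
  rw [e]
  refine h.congr_deriv ?_
  have := (Real.cosh_pos x).ne'
  simp only [Pi.div_apply]
  field_simp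

theorem contDiff_tanh : ContDiff ℝ (⊤ : ℕ∞) Real.tanh := by
  have e : Real.tanh = fun y ↦ Real.sinh y / Real.cosh y := by
    ext y
    exact Real.tanh_eq_sinh_div_cosh y
  rw [e]
  exact Real.contDiff_sinh.div Real.contDiff_cosh fun y ↦ (Real.cosh_pos y).ne'

theorem tanh_nonneg {x : ℝ} (hx : 0 ≤ x) : 0 ≤ Real.tanh x := by
  rw [Real.tanh_eq_sinh_div_cosh]
  exact div_nonneg (Real.sinh_nonneg_iff.2 hx) (Real.cosh_pos x).le

theorem tanh_pos {x : ℝ} (hx : 0 < x) : 0 < Real.tanh x := by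
  rw [Real.tanh_eq_sinh_div_cosh]
  exact div_pos (Real.sinh_pos_iff.2 hx) (Real.cosh_pos x)

theorem div_one_add_le_tanh {x : ℝ} (hx : 0 ≤ x) : x / (1 + x) ≤ Real.tanh x := by
  rw [Real.tanh_eq]
  have h1 := Real.exp_pos x
  have h2 : Real.exp x * Real.exp (-x) = 1 := by rw [← Real.exp_add]; simp
  have h3 : Real.exp (-x) * (1 + 2 * x) ≤ Real.exp x := by
    have h4 : 2 * x + 1 ≤ Real.exp (2 * x) := Real.add_one_le_exp _
    have h5 : Real.exp (2 * x) = Real.exp x * Real.exp x := by rw [← Real.exp_add]; ring_nf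
    have h6 := mul_le_mul_of_nonneg_left h4 (Real.exp_pos (-x)).le
    calc _ = Real.exp (-x) * (2 * x + 1) := by ring
      _ ≤ _ := h6
      _ = (Real.exp x * Real.exp (-x)) * Real.exp x := by rw [h5]; ring
      _ = _ := by rw [h2, one_mul]
  rw [div_le_div_iff₀ (by linarith) (by positivity)]
  nlinarith

theorem tanh_le_self {x : ℝ} (hx : 0 ≤ x) : Real.tanh x ≤ x := by
  have hm : MonotoneOn (fun y ↦ y - Real.tanh y) (Set.Ici 0) := by
    refine monotoneOn_of_hasDerivWithinAt_nonneg (convex_Ici 0)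
      (f' := fun y ↦ 1 - (1 - Real.tanh y ^ 2)) ?_ ?_ ?_
    · exact fun y _ ↦ ((hasDerivAt_id y).sub (hasDerivAt_tanh y)).continuousAt.continuousWithinAt
    · exact fun y _ ↦ ((hasDerivAt_id y).sub (hasDerivAt_tanh y)).hasDerivWithinAt
    · intro y _
      nlinarith [sq_nonneg (Real.tanh y)]
  have := hm (Set.mem_Ici.2 le_rfl) (Set.mem_Ici.2 hx) hx
  simpa using this

/-- The difference of the two sides vanishes at 0 and has derivative 2x tanh x (1 - tanh² x) ≥ 0.
This is what puts the group velocity below the phase velocity. -/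
theorem mul_one_sub_tanh_sq_le {x : ℝ} (hx : 0 ≤ x) :
    x * (1 - Real.tanh x ^ 2) ≤ Real.tanh x := by
  have hd : ∀ y : ℝ, HasDerivAt (fun y ↦ Real.tanh y - y * (1 - Real.tanh y ^ 2))
      (2 * y * Real.tanh y * (1 - Real.tanh y ^ 2)) y := fun y ↦ by
    refine ((hasDerivAt_tanh y).sub ((hasDerivAt_id y).mul
      (((hasDerivAt_tanh y).pow 2).const_sub 1))).congr_deriv ?_
    simp
    ring
  have hm : MonotoneOn (fun y ↦ Real.tanh y - y * (1 - Real.tanh y ^ 2)) (Set.Ici 0) := by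
    refine monotoneOn_of_hasDerivWithinAt_nonneg (convex_Ici 0)
      (fun y _ ↦ (hd y).continuousAt.continuousWithinAt)
      (fun y _ ↦ (hd y).hasDerivWithinAt) ?_
    intro y hy
    rw [interior_Ici] at hy
    have h1 := tanh_nonneg (le_of_lt hy)
    have h2 := Real.tanh_sq_lt_one y
    have h3 : 0 ≤ y := le_of_lt hy
    have h4 : 0 ≤ 1 - Real.tanh y ^ 2 := by linarith
    positivity
  have := hm (Set.mem_Ici.2 le_rfl) (Set.mem_Ici.2 hx) hx
  simpa using this

theorem tanh_le_two_mul_div {x : ℝ} (hx : 0 ≤ x) : Real.tanh x ≤ 2 * x / (1 + x) := by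
  rw [le_div_iff₀ (by linarith)]
  nlinarith [tanh_le_self hx, Real.tanh_lt_one x]

/-- The right side is the numerator of `dispersion` at x = √μ ξ. The first square can vanish only
where x(1 - tanh² x) is comparable to tanh x, and there the second term takes over; hence the case
split at tanh x / 2. -/
theorem convexity_defect_lower_bound {x : ℝ} (hx : 0 ≤ x) :
    (x / (1 + x)) ^ 4 / 4 ≤ (Real.tanh x - x * (1 - Real.tanh x ^ 2)) ^ 2 +
      4 * x ^ 2 * Real.tanh x ^ 2 * (1 - Real.tanh x ^ 2) := by
  have h1 := tanh_nonneg hx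
  have h2 := Real.tanh_sq_lt_one x
  have h3 := div_one_add_le_tanh hx
  have h3' := tanh_le_self hx
  have h7 := Real.tanh_lt_one x
  set τ := Real.tanh x
  set y := x / (1 + x)
  have hy : 0 ≤ y := by positivity
  have h4 : y ^ 4 ≤ τ ^ 4 := pow_le_pow_left₀ hy h3 4
  have h5 : 0 ≤ x * (1 - τ ^ 2) := mul_nonneg hx (by linarith)
  have h6 : τ ^ 4 ≤ τ ^ 2 := by nlinarith [sq_nonneg τ]
  by_cases h : x * (1 - τ ^ 2) ≤ τ / 2
  · have : (τ / 2) ^ 2 ≤ (τ - x * (1 - τ ^ 2)) ^ 2 :=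
      pow_le_pow_left₀ (by linarith) (by linarith) 2
    have : 0 ≤ 4 * x * τ ^ 2 * (x * (1 - τ ^ 2)) := by positivity
    nlinarith
  · have h8 : τ / 2 ≤ x * (1 - τ ^ 2) := by linarith
    have h9 : 4 * τ * τ ^ 2 * (τ / 2) ≤ 4 * x * τ ^ 2 * (x * (1 - τ ^ 2)) := by gcongr
    nlinarith [sq_nonneg (τ - x * (1 - τ ^ 2)), pow_nonneg h1 4]

/-! ### The dispersion relation: parity, square-root formula, size. -/

theorem waveOmega_neg (x : ℝ) : waveOmega (-x) = waveOmega x := by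
  simp [waveOmega, Real.tanh_neg]

theorem waveOmega_abs (x : ℝ) : waveOmega |x| = waveOmega x := by
  rcases abs_choice x with h | h <;> simp [h, waveOmega_neg]

theorem one_div_one_add_abs_le_waveOmega (x : ℝ) : 1 / (1 + |x|) ≤ waveOmega x := by
  rw [← waveOmega_abs]
  have hx := abs_nonneg x
  generalize |x| = y at hx
  unfold waveOmega
  split_ifs with h
  · simp [h]
  · apply Real.le_sqrt_of_sq_le
    have hy : 0 < y := lt_of_le_of_ne hx (Ne.symm h)
    rw [le_div_iff₀ hy]
    refine le_trans ?_ (div_one_add_le_tanh hx)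
    rw [div_pow, one_pow, div_mul_eq_mul_div, one_mul]
    apply div_le_div_of_nonneg_left hx (by linarith)
    nlinarith

theorem disp_neg (μ ξ : ℝ) : disp μ (-ξ) = -disp μ ξ := by
  simp [disp, waveOmega_neg]

theorem disp_zero (μ : ℝ) : disp μ 0 = 0 := by simp [disp]

theorem disp_eq_sqrt {μ ξ : ℝ} (hμ : 0 < μ) (hξ : 0 < ξ) :
    disp μ ξ = √(ξ * Real.tanh (√μ * ξ) / √μ) := by
  have hm : 0 < √μ := Real.sqrt_pos.2 hμ
  have h : √μ * ξ ≠ 0 := by positivity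
  rw [disp, waveOmega, if_neg h]
  have : ξ * Real.tanh (√μ * ξ) / √μ = ξ ^ 2 * (Real.tanh (√μ * ξ) / (√μ * ξ)) := by
    field_simp
  rw [this, Real.sqrt_mul (by positivity), Real.sqrt_sq hξ.le]

theorem disp_pos {μ ξ : ℝ} (hμ : 0 < μ) (hξ : 0 < ξ) : 0 < disp μ ξ := by
  have hm : 0 < √μ := Real.sqrt_pos.2 hμ
  have := tanh_pos (mul_pos hm hξ)
  rw [disp_eq_sqrt hμ hξ]
  positivity

theorem disp_sq {μ ξ : ℝ} (hμ : 0 < μ) (hξ : 0 < ξ) :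
    disp μ ξ ^ 2 = ξ * Real.tanh (√μ * ξ) / √μ := by
  have hm : 0 < √μ := Real.sqrt_pos.2 hμ
  have := tanh_pos (mul_pos hm hξ)
  rw [disp_eq_sqrt hμ hξ, Real.sq_sqrt (by positivity)]

theorem disp_sq_le {μ ξ : ℝ} (hμ : 0 < μ) (hξ : 0 < ξ) :
    disp μ ξ ^ 2 ≤ 2 * ξ ^ 2 / (1 + √μ * ξ) := by
  have hm : 0 < √μ := Real.sqrt_pos.2 hμ
  have h0 : 0 < √μ * ξ := by positivity
  rw [disp_sq hμ hξ, div_le_iff₀ hm]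
  refine (mul_le_mul_of_nonneg_left (tanh_le_two_mul_div h0.le) hξ.le).trans (le_of_eq ?_)
  field_simp

theorem disp_le_self {μ ξ : ℝ} (hμ : 0 < μ) (hξ : 0 < ξ) : disp μ ξ ≤ ξ := by
  have hm : 0 < √μ := Real.sqrt_pos.2 hμ
  refine (pow_le_pow_iff_left₀ (disp_pos hμ hξ).le hξ.le two_ne_zero).1 ?_
  rw [disp_sq hμ hξ, div_le_iff₀ hm]
  nlinarith [tanh_le_self (mul_pos hm hξ).le]

/-! ### Group velocity and strict concavity of the dispersion relation. -/

/-- The group velocity, at positive wave numbers. -/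
noncomputable def groupVelocity (μ ξ : ℝ) : ℝ :=
  (Real.tanh (√μ * ξ) + √μ * ξ * (1 - Real.tanh (√μ * ξ) ^ 2)) / √μ / (2 * disp μ ξ)

/-- The opposite of the derivative of the group velocity, at positive wave numbers. -/
noncomputable def dispersion (μ ξ : ℝ) : ℝ :=
  ((Real.tanh (√μ * ξ) - √μ * ξ * (1 - Real.tanh (√μ * ξ) ^ 2)) ^ 2 +
    4 * (√μ * ξ) ^ 2 * Real.tanh (√μ * ξ) ^ 2 * (1 - Real.tanh (√μ * ξ) ^ 2)) /
    (4 * √μ ^ 2 * disp μ ξ ^ 3)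

theorem hasDerivAt_tanh_mul (m ξ : ℝ) :
    HasDerivAt (fun ξ ↦ Real.tanh (m * ξ)) ((1 - Real.tanh (m * ξ) ^ 2) * m) ξ := by
  have h := (hasDerivAt_id ξ).const_mul m
  simp only [id, mul_one] at h
  exact (hasDerivAt_tanh (m * ξ)).comp ξ h

theorem hasDerivAt_disp {μ ξ : ℝ} (hμ : 0 < μ) (hξ : 0 < ξ) :
    HasDerivAt (disp μ) (groupVelocity μ ξ) ξ := by
  have hm : 0 < √μ := Real.sqrt_pos.2 hμ
  have hτ := tanh_pos (mul_pos hm hξ)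
  have hg : HasDerivAt (fun ξ ↦ ξ * Real.tanh (√μ * ξ) / √μ)
      ((Real.tanh (√μ * ξ) + √μ * ξ * (1 - Real.tanh (√μ * ξ) ^ 2)) / √μ) ξ := by
    refine (((hasDerivAt_id ξ).mul (hasDerivAt_tanh_mul √μ ξ)).div_const √μ).congr_deriv ?_
    simp
    ring
  have h := hg.sqrt (by positivity)
  rw [← disp_eq_sqrt hμ hξ] at h
  refine h.congr_of_eventuallyEq ?_
  filter_upwards [lt_mem_nhds hξ] with y hy using disp_eq_sqrt hμ hy

/-- With g = φ² one has φ'' = (2 g g'' - g'²)/(4 φ³). For τ = tanh x, x = √μ ξ and s = 1 - τ², the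
cross terms recombine by (τ + xs)² - 4xτs = (τ - xs)², so that -φ'' is visibly nonnegative. -/
theorem hasDerivAt_groupVelocity {μ ξ : ℝ} (hμ : 0 < μ) (hξ : 0 < ξ) :
    HasDerivAt (groupVelocity μ) (-dispersion μ ξ) ξ := by
  have hm : 0 < √μ := Real.sqrt_pos.2 hμ
  have hd := disp_pos hμ hξ
  have hs := disp_sq hμ hξ
  have hid := (hasDerivAt_id ξ).const_mul √μ
  have hn := (((hasDerivAt_tanh_mul √μ ξ).add (hid.mul
    (((hasDerivAt_tanh_mul √μ ξ).pow 2).const_sub 1))).div_const √μ)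
  have h := hn.div ((hasDerivAt_disp hμ hξ).const_mul 2) (by positivity)
  refine h.congr_deriv ?_
  simp only [groupVelocity, dispersion, id]
  set τ := Real.tanh (√μ * ξ)
  set φ := disp μ ξ
  set m := √μ
  have hs' : φ ^ 2 * m = ξ * τ := by rw [hs]; field_simp
  simp
  field_simp
  linear_combination (16 * m * (1 - τ ^ 2) * (1 - m * ξ * τ)) * hs'

theorem groupVelocity_nonneg {μ ξ : ℝ} (hμ : 0 < μ) (hξ : 0 < ξ) : 0 ≤ groupVelocity μ ξ := by
  have hm : 0 < √μ := Real.sqrt_pos.2 hμ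
  have hd := disp_pos hμ hξ
  have hτ := tanh_pos (mul_pos hm hξ)
  have := Real.tanh_sq_lt_one (√μ * ξ)
  have : 0 ≤ 1 - Real.tanh (√μ * ξ) ^ 2 := by linarith
  unfold groupVelocity
  positivity

theorem groupVelocity_le_div {μ ξ : ℝ} (hμ : 0 < μ) (hξ : 0 < ξ) :
    groupVelocity μ ξ ≤ disp μ ξ / ξ := by
  have hm : 0 < √μ := Real.sqrt_pos.2 hμ
  have hd := disp_pos hμ hξ
  have hs := disp_sq hμ hξ
  have h1 := mul_one_sub_tanh_sq_le (mul_pos hm hξ).le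
  unfold groupVelocity
  rw [div_le_div_iff₀ (by positivity) hξ, div_mul_eq_mul_div, div_le_iff₀ hm]
  have : disp μ ξ * (2 * disp μ ξ) * √μ = 2 * (ξ * Real.tanh (√μ * ξ)) := by
    rw [show disp μ ξ * (2 * disp μ ξ) * √μ = 2 * (disp μ ξ ^ 2 * √μ) by ring, hs]
    field_simp
  rw [this]
  nlinarith

theorem groupVelocity_le_one {μ ξ : ℝ} (hμ : 0 < μ) (hξ : 0 < ξ) : groupVelocity μ ξ ≤ 1 :=
  (groupVelocity_le_div hμ hξ).trans ((div_le_one hξ).2 (disp_le_self hμ hξ))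

/-- The numerator is at least (x/(1+x))⁴/4 with x = √μ ξ, and φ³ = φ²·φ ≤ 2ξ³/(1+x) in the
denominator; the constant is 32 = 4·4·2. -/
theorem le_dispersion {μ ξ : ℝ} (hμ : 0 < μ) (hξ : 0 < ξ) :
    √μ ^ 2 * ξ / (32 * (1 + √μ * ξ) ^ 3) ≤ dispersion μ ξ := by
  have hm : 0 < √μ := Real.sqrt_pos.2 hμ
  have hd := disp_pos hμ hξ
  have h1 := convexity_defect_lower_bound (mul_pos hm hξ).le
  have h2 : disp μ ξ ^ 3 ≤ 2 * ξ ^ 3 / (1 + √μ * ξ) := by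
    calc disp μ ξ ^ 3 = disp μ ξ ^ 2 * disp μ ξ := by ring
      _ ≤ 2 * ξ ^ 2 / (1 + √μ * ξ) * ξ :=
        mul_le_mul (disp_sq_le hμ hξ) (disp_le_self hμ hξ) hd.le (by positivity)
      _ = _ := by ring
  unfold dispersion
  refine le_trans ?_ (div_le_div₀ (le_trans (by positivity) h1) h1 (by positivity)
    (mul_le_mul_of_nonneg_left h2 (by positivity)))
  apply le_of_eq
  field_simp
  ring

/-! ### A weighted van der Corput estimate. -/

/-- The derivative of `e^{iψ}` for a real phase `ψ`. -/
theorem HasDerivAt.cexp_I_mul {ψ : ℝ → ℝ} {p x : ℝ} (h : HasDerivAt ψ p x) :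
    HasDerivAt (fun x ↦ Complex.exp (Complex.I * ψ x))
      (Complex.exp (Complex.I * ψ x) * (Complex.I * p)) x :=
  (h.ofReal_comp.const_mul Complex.I).cexp

theorem abs_div_one_add_sq_le (q : ℝ) : |q / (1 + q ^ 2)| ≤ 1 / 2 := by
  have hq2 : 0 < 1 + q ^ 2 := by positivity
  rw [abs_div, abs_of_pos hq2, div_le_div_iff₀ hq2 two_pos]
  nlinarith [sq_nonneg (|q| - 1), sq_abs q]

/-- The main terms are paid for by the derivative of 2B arctan q. Since p'/ρ ≥ ρ, one has ρ + |q'| ≤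
2q' + 3|q ρ'/ρ|, and |q|/(1+q²) ≤ 1/2 turns the last term into the error 3/2 B|ρ'/ρ|.
Differentiating B costs at most π|B'| through the arctangent and |B'|/2 through q/(1+q²). -/
theorem van_der_corput_pointwise {B B' ρ ρ' p' q q' R' : ℝ} (hB : 0 ≤ B) (hρ : 0 < ρ)
    (hp : ρ ^ 2 ≤ p') (hq : q' = p' / ρ - q * (ρ' / ρ))
    (hR : (Real.pi + 1 / 2) * |B'| + 3 / 2 * (B * |ρ' / ρ|) ≤ R') :
    |B' * (q / (1 + q ^ 2)) + B * (q' * (1 - q ^ 2) / (1 + q ^ 2) ^ 2)| + B * ρ / (1 + q ^ 2) ≤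
      2 * B' * Real.arctan q + 2 * B * (1 / (1 + q ^ 2) * q') + R' := by
  have hq2 : 0 < 1 + q ^ 2 := by positivity
  have h1 := abs_div_one_add_sq_le q
  have h2 : |(1 - q ^ 2) / (1 + q ^ 2)| ≤ 1 := by
    rw [abs_div, abs_of_pos hq2, div_le_one hq2, abs_le]
    constructor <;> nlinarith [sq_nonneg q]
  have h3 : -(Real.pi * |B'|) ≤ 2 * B' * Real.arctan q := by
    have h4 : |Real.arctan q| ≤ Real.pi / 2 :=
      abs_le.2 ⟨(Real.neg_pi_div_two_lt_arctan q).le, (Real.arctan_lt_pi_div_two q).le⟩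
    have h5 : |B' * Real.arctan q| ≤ |B'| * (Real.pi / 2) := by
      rw [abs_mul]
      gcongr
    linarith [neg_abs_le (B' * Real.arctan q)]
  have h4 : |B' * (q / (1 + q ^ 2))| ≤ |B'| * (1 / 2) := by
    rw [abs_mul]
    gcongr
  have h5 : |B * (q' * (1 - q ^ 2) / (1 + q ^ 2) ^ 2)| ≤ B * (|q'| / (1 + q ^ 2)) := by
    have : q' * (1 - q ^ 2) / (1 + q ^ 2) ^ 2 =
        q' / (1 + q ^ 2) * ((1 - q ^ 2) / (1 + q ^ 2)) := by field_simp
    rw [this, abs_mul, abs_mul, abs_of_nonneg hB, abs_div, abs_of_pos hq2]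
    exact mul_le_mul_of_nonneg_left (mul_le_of_le_one_right (by positivity) h2) hB
  set r := ρ' / ρ
  have h6 : ρ ≤ p' / ρ := by
    rw [le_div_iff₀ hρ]
    nlinarith
  have h7 : |q'| ≤ p' / ρ + |q * r| := by
    rw [hq]
    refine (abs_sub _ _).trans ?_
    rw [abs_of_nonneg (hρ.le.trans h6)]
  have h8 : |q * r| / (1 + q ^ 2) ≤ |r| / 2 := by
    rw [show |q * r| / (1 + q ^ 2) = |q / (1 + q ^ 2)| * |r| by
      rw [abs_mul q r, abs_div q, abs_of_pos hq2]; ring]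
    nlinarith [abs_nonneg r]
  have h9 : ρ / (1 + q ^ 2) + |q'| / (1 + q ^ 2) ≤ 2 * (1 / (1 + q ^ 2) * q') + 3 / 2 * |r| := by
    have : ρ + |q'| ≤ 2 * q' + 3 * |q * r| := by
      have := le_abs_self (q * r)
      linarith
    have := div_le_div_of_nonneg_right this hq2.le
    calc _ = (ρ + |q'|) / (1 + q ^ 2) := by ring
      _ ≤ (2 * q' + 3 * |q * r|) / (1 + q ^ 2) := this
      _ = 2 * (1 / (1 + q ^ 2) * q') + 3 * (|q * r| / (1 + q ^ 2)) := by ring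
      _ ≤ _ := by linarith
  have h10 := mul_le_mul_of_nonneg_left h9 hB
  have h11 := abs_add_le (B' * (q / (1 + q ^ 2))) (B * (q' * (1 - q ^ 2) / (1 + q ^ 2) ^ 2))
  have h12 : B * ρ / (1 + q ^ 2) = B * (ρ / (1 + q ^ 2)) := by ring
  rw [h12]
  nlinarith

/-- A weighted van der Corput estimate: the second derivative of the phase is bounded from below
by the square of a variable weight `ρ`. -/
theorem norm_integral_mul_cexp_le {ψ p p' ρ ρ' B B' R R' : ℝ → ℝ}
    (hψ : ∀ x, 0 < x → HasDerivAt ψ (p x) x) (hp : ∀ x, 0 < x → HasDerivAt p (p' x) x)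
    (hρ : ∀ x, 0 < x → HasDerivAt ρ (ρ' x) x) (hB : ∀ x, 0 < x → HasDerivAt B (B' x) x)
    (hR : ∀ x, 0 < x → HasDerivAt R (R' x) x)
    (hρ0 : ∀ x, 0 < x → 0 < ρ x) (hB0 : ∀ x, 0 < x → 0 ≤ B x)
    (hpρ : ∀ x, 0 < x → ρ x ^ 2 ≤ p' x)
    (hR' : ∀ x, 0 < x → (Real.pi + 1 / 2) * |B' x| + 3 / 2 * (B x * |ρ' x / ρ x|) ≤ R' x)
    {a b : ℝ} (ha : 0 < a) (hab : a ≤ b) :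
    ‖∫ x in a..b, ((B x * ρ x : ℝ) : ℂ) * Complex.exp (Complex.I * ψ x)‖ ≤
      (Real.pi + 1 / 2) * (B a + B b) + (R b - R a) := by
  set f : ℝ → ℂ := fun x ↦ ((B x * ρ x : ℝ) : ℂ) * Complex.exp (Complex.I * ψ x) with hf
  set q : ℝ → ℝ := fun x ↦ p x / ρ x with hqdef
  set q' : ℝ → ℝ := fun x ↦ p' x / ρ x - q x * (ρ' x / ρ x) with hq'def
  have hq : ∀ x, 0 < x → HasDerivAt q (q' x) x := fun x hx ↦ by
    have := (hρ0 x hx).ne'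
    refine ((hp x hx).div (hρ x hx) this).congr_deriv ?_
    simp only [hq'def, hqdef]
    field_simp
  have hfc : ContinuousOn f (Set.Ioi 0) := fun x hx ↦
    (((hB x hx).mul (hρ x hx)).ofReal_comp.continuousAt.mul
      (hψ x hx).cexp_I_mul.continuousAt).continuousWithinAt
  -- Integrating by parts with B q/(1+q²) instead of Bρ/p = B/q avoids cutting out a neighbourhood
  -- of the stationary point: r is smooth where p vanishes, and since r p = Bρ - Bρ/(1+q²), the
  -- remainder Bρ/(1+q²) is small away from it.
  set r : ℝ → ℝ := fun x ↦ B x * (q x / (1 + q x ^ 2)) with hrdef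
  set r' : ℝ → ℝ := fun x ↦ B' x * (q x / (1 + q x ^ 2)) +
    B x * (q' x * (1 - q x ^ 2) / (1 + q x ^ 2) ^ 2) with hr'def
  have hr : ∀ x, 0 < x → HasDerivAt r (r' x) x := fun x hx ↦ by
    have h1 : 1 + q x ^ 2 ≠ 0 := by positivity
    refine ((hB x hx).mul ((hq x hx).div (((hq x hx).pow 2).const_add 1) h1)).congr_deriv ?_
    have e : 2 * q x ^ (2 - 1) * q' x = 2 * q x * q' x := by norm_num
    simp only [hr'def, Pi.pow_apply, Pi.div_apply, Nat.cast_ofNat, e]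
    field_simp
    ring
  have hint : ∀ x, 0 < x → HasDerivAt (fun y ↦ ∫ t in a..y, f t) (f x) x := fun x hx ↦ by
    apply intervalIntegral.integral_hasDerivAt_right
    · apply ContinuousOn.intervalIntegrable
      refine hfc.mono fun y hy ↦ ?_
      rw [Set.mem_uIcc] at hy
      rcases hy with h | h <;> exact lt_of_lt_of_le (by assumption) h.1
    · exact hfc.stronglyMeasurableAtFilter isOpen_Ioi x hx
    · exact hfc.continuousAt (Ioi_mem_nhds hx)
  set Φ : ℝ → ℂ := fun x ↦ Complex.I * (∫ t in a..x, f t) -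
    ((r x : ℂ) * Complex.exp (Complex.I * ψ x) - (r a : ℂ) * Complex.exp (Complex.I * ψ a))
    with hΦdef
  set Φ' : ℝ → ℂ := fun x ↦ Complex.I * f x - ((r' x : ℂ) * Complex.exp (Complex.I * ψ x) +
    (r x : ℂ) * (Complex.exp (Complex.I * ψ x) * (Complex.I * p x))) with hΦ'def
  have hΦ : ∀ x, 0 < x → HasDerivAt Φ (Φ' x) x := fun x hx ↦
    ((hint x hx).const_mul Complex.I).sub
      (((hr x hx).ofReal_comp.mul (hψ x hx).cexp_I_mul).sub_const _)
  -- Majorant of Φ: the arctangent bounds the total contribution of the stationary region, whatever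
  -- the size of the phase.
  set D : ℝ → ℝ := fun x ↦ 2 * B x * Real.arctan (q x) + R x -
    (2 * B a * Real.arctan (q a) + R a) with hDdef
  have hD : ∀ x, 0 < x → HasDerivAt D
      (2 * B' x * Real.arctan (q x) + 2 * B x * (1 / (1 + q x ^ 2) * q' x) + R' x) x :=
    fun x hx ↦ ((((hB x hx).const_mul 2).mul (hq x hx).arctan).add (hR x hx)).sub_const _
  have hexp : ∀ x, ‖Complex.exp (Complex.I * ψ x)‖ = 1 := fun x ↦ by
    rw [mul_comm, Complex.norm_exp_ofReal_mul_I]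
  have hbound : ∀ x, 0 < x → ‖Φ' x‖ ≤
      2 * B' x * Real.arctan (q x) + 2 * B x * (1 / (1 + q x ^ 2) * q' x) + R' x := by
    intro x hx
    refine le_trans ?_ (van_der_corput_pointwise (hB0 x hx) (hρ0 x hx) (hpρ x hx) rfl (hR' x hx))
    have e : Φ' x = Complex.exp (Complex.I * ψ x) *
        (((B x * ρ x / (1 + q x ^ 2) : ℝ) : ℂ) * Complex.I - (r' x : ℂ)) := by
      have e1 : B x * ρ x / (1 + q x ^ 2) = B x * ρ x - r x * p x := by
        have : p x = q x * ρ x := by simp only [hqdef]; field_simp [(hρ0 x hx).ne']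
        have h1 : 1 + q x ^ 2 ≠ 0 := by positivity
        rw [this]
        simp only [hrdef]
        field_simp
        ring
      rw [e1]
      simp only [hΦ'def, hf]
      push_cast
      ring
    rw [e, norm_mul, hexp, one_mul]
    refine (norm_sub_le _ _).trans ?_
    rw [norm_mul, Complex.norm_I, mul_one, Complex.norm_real, Complex.norm_real, add_comm,
      Real.norm_eq_abs, Real.norm_eq_abs]
    refine add_le_add le_rfl (le_of_eq (abs_of_nonneg ?_))
    have := hB0 x hx
    have := hρ0 x hx
    positivity
  have hpos : ∀ x ∈ Set.Icc a b, 0 < x := fun x hx ↦ ha.trans_le hx.1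
  -- Comparing ‖Φ'‖ with D' pointwise gives ‖Φ b‖ ≤ D b without any integrability of Φ' or D'.
  have key := image_norm_le_of_norm_deriv_right_le_deriv_boundary' (f := Φ) (f' := Φ') (B := D)
    (a := a) (b := b)
    (fun x hx ↦ (hΦ x (hpos x hx)).continuousAt.continuousWithinAt)
    (fun x hx ↦ (hΦ x (hpos x ⟨hx.1, hx.2.le⟩)).hasDerivWithinAt) (by simp [hΦdef, hDdef])
    (fun x hx ↦ (hD x (hpos x hx)).continuousAt.continuousWithinAt)
    (fun x hx ↦ (hD x (hpos x ⟨hx.1, hx.2.le⟩)).hasDerivWithinAt)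
    (fun x hx ↦ hbound x (hpos x ⟨hx.1, hx.2.le⟩)) (Set.right_mem_Icc.2 hab)
  have hrb : ∀ x, 0 < x → ‖(r x : ℂ) * Complex.exp (Complex.I * ψ x)‖ ≤ B x / 2 := by
    intro x hx
    rw [norm_mul, hexp, mul_one, Complex.norm_real, Real.norm_eq_abs, abs_mul,
      abs_of_nonneg (hB0 x hx), div_eq_mul_one_div (B x)]
    exact mul_le_mul_of_nonneg_left (abs_div_one_add_sq_le (q x)) (hB0 x hx)
  have harc : ∀ x, 0 < x → |2 * B x * Real.arctan (q x)| ≤ Real.pi * B x := by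
    intro x hx
    have h4 : |Real.arctan (q x)| ≤ Real.pi / 2 :=
      abs_le.2 ⟨(Real.neg_pi_div_two_lt_arctan _).le, (Real.arctan_lt_pi_div_two _).le⟩
    rw [abs_mul, abs_of_nonneg (mul_nonneg zero_le_two (hB0 x hx))]
    nlinarith [hB0 x hx]
  have hb : 0 < b := ha.trans_le hab
  have e : (∫ x in a..b, f x) = -Complex.I * (Φ b + ((r b : ℂ) * Complex.exp (Complex.I * ψ b) -
      (r a : ℂ) * Complex.exp (Complex.I * ψ a))) := by
    simp only [hΦdef]
    linear_combination (∫ x in a..b, f x) * Complex.I_sq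
  rw [e, norm_mul, norm_neg, Complex.norm_I, one_mul]
  refine (norm_add_le _ _).trans ?_
  have h1 := norm_sub_le ((r b : ℂ) * Complex.exp (Complex.I * ψ b))
    ((r a : ℂ) * Complex.exp (Complex.I * ψ a))
  have h2 := hrb a ha
  have h3 := hrb b hb
  have h4 := (abs_le.1 (harc b hb)).2
  have h5 := (abs_le.1 (harc a ha)).1
  simp only [hDdef] at key
  linarith

/-! ### Global bounds on the dispersion relation; weight and amplitude for van der Corput. -/

theorem abs_disp_le_self {μ : ℝ} (hμ : 0 < μ) (ξ : ℝ) : |disp μ ξ| ≤ |ξ| := by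
  rcases lt_trichotomy ξ 0 with h | h | h
  · have := disp_le_self hμ (neg_pos.2 h)
    have h2 := disp_pos hμ (neg_pos.2 h)
    rw [disp_neg] at this h2
    rw [abs_of_neg h, abs_of_neg (by linarith)]
    exact this
  · simp [h, disp_zero]
  · rw [abs_of_pos h, abs_of_pos (disp_pos hμ h)]
    exact disp_le_self hμ h

theorem abs_disp_le_sqrt {μ : ℝ} (hμ : 0 < μ) (ξ : ℝ) : |disp μ ξ| ≤ √(|ξ| / √μ) := by
  have hm : 0 < √μ := Real.sqrt_pos.2 hμ
  have key : ∀ ξ, 0 < ξ → disp μ ξ ≤ √(ξ / √μ) := fun ξ hξ ↦ by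
    rw [disp_eq_sqrt hμ hξ]
    gcongr
    exact mul_le_of_le_one_right hξ.le (Real.tanh_lt_one _).le
  rcases lt_trichotomy ξ 0 with h | h | h
  · have := key _ (neg_pos.2 h)
    have h2 := disp_pos hμ (neg_pos.2 h)
    rw [disp_neg] at this h2
    rw [abs_of_neg h, abs_of_neg (by linarith)]
    exact this
  · simp [h, disp_zero]
  · rw [abs_of_pos h, abs_of_pos (disp_pos hμ h)]
    exact key ξ h

theorem measurable_disp (μ : ℝ) : Measurable (disp μ) := by
  have h1 : Measurable Real.tanh := contDiff_tanh.continuous.measurable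
  have h2 : Measurable waveOmega :=
    Measurable.ite (measurableSet_singleton 0) measurable_const
      (h1.div measurable_id).sqrt
  exact measurable_id.mul (h2.comp (measurable_const.mul measurable_id))

/-- The weight for the van der Corput estimate. -/
noncomputable def vdcWeight (μ t ξ : ℝ) : ℝ := √(t * (√μ ^ 2 * ξ / (32 * (1 + √μ * ξ) ^ 3)))

theorem vdcWeight_pos {μ t ξ : ℝ} (hμ : 0 < μ) (ht : 0 < t) (hξ : 0 < ξ) :
    0 < vdcWeight μ t ξ := by
  have hm : 0 < √μ := Real.sqrt_pos.2 hμ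
  unfold vdcWeight
  positivity

/-- The logarithmic derivative of `vdcWeight`. -/
noncomputable def vdcWeightLogDeriv (μ ξ : ℝ) : ℝ := (1 / ξ - 3 * √μ / (1 + √μ * ξ)) / 2

theorem abs_vdcWeightLogDeriv_le {μ ξ : ℝ} (hμ : 0 < μ) (hξ : 0 < ξ) :
    |vdcWeightLogDeriv μ ξ| ≤ 1 / ξ := by
  have hm : 0 < √μ := Real.sqrt_pos.2 hμ
  have h1 : √μ / (1 + √μ * ξ) ≤ 1 / ξ := by
    rw [div_le_div_iff₀ (by positivity) hξ]
    linarith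
  have h2 : 0 ≤ √μ / (1 + √μ * ξ) := by positivity
  have h3 : 0 < 1 / ξ := by positivity
  have : 3 * √μ / (1 + √μ * ξ) = 3 * (√μ / (1 + √μ * ξ)) := by ring
  unfold vdcWeightLogDeriv
  rw [this, abs_le]
  constructor <;> linarith

theorem hasDerivAt_vdcWeight {μ t ξ : ℝ} (hμ : 0 < μ) (ht : 0 < t) (hξ : 0 < ξ) :
    HasDerivAt (vdcWeight μ t) (vdcWeight μ t ξ * vdcWeightLogDeriv μ ξ) ξ := by
  have hm : 0 < √μ := Real.sqrt_pos.2 hμ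
  have hw := vdcWeight_pos hμ ht hξ
  have hsq : vdcWeight μ t ξ ^ 2 = t * (√μ ^ 2 * ξ / (32 * (1 + √μ * ξ) ^ 3)) :=
    Real.sq_sqrt (by positivity)
  have hd : 32 * (1 + √μ * ξ) ^ 3 ≠ 0 := by positivity
  have h1 := (((((hasDerivAt_id ξ).const_mul √μ).const_add 1).pow 3).const_mul 32)
  have h2 := (((hasDerivAt_id ξ).const_mul (√μ ^ 2)).div h1 hd).const_mul t
  have h3 := h2.sqrt (ne_of_gt (by simp only [Pi.pow_apply, Pi.div_apply, id]; positivity))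
  refine h3.congr_deriv ?_
  simp only [Pi.pow_apply, Pi.div_apply, id]
  change _ / (2 * vdcWeight μ t ξ) = _
  rw [div_eq_iff (by positivity)]
  rw [show vdcWeight μ t ξ * vdcWeightLogDeriv μ ξ * (2 * vdcWeight μ t ξ) =
    vdcWeight μ t ξ ^ 2 * (2 * vdcWeightLogDeriv μ ξ) by ring, hsq, vdcWeightLogDeriv]
  have h4 : 1 + √μ * ξ ≠ 0 := by positivity
  simp only [Nat.cast_ofNat, Nat.reduceSub]
  field_simp

/-- The amplitude of the kernel divided by the weight. -/
noncomputable def vdcAmplitude (μ t ξ : ℝ) : ℝ := disp μ ξ / ((1 + ξ ^ 2) * vdcWeight μ t ξ)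

theorem hasDerivAt_vdcAmplitude {μ t ξ : ℝ} (hμ : 0 < μ) (ht : 0 < t) (hξ : 0 < ξ) :
    HasDerivAt (vdcAmplitude μ t) (vdcAmplitude μ t ξ *
      (groupVelocity μ ξ / disp μ ξ - 2 * ξ / (1 + ξ ^ 2) - vdcWeightLogDeriv μ ξ)) ξ := by
  have hw := vdcWeight_pos hμ ht hξ
  have hd := disp_pos hμ hξ
  have h := (hasDerivAt_disp hμ hξ).div
    ((((hasDerivAt_id ξ).pow 2).const_add 1).mul (hasDerivAt_vdcWeight hμ ht hξ))
    (ne_of_gt (by simp only [Pi.pow_apply, Pi.mul_apply, id]; positivity))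
  refine h.congr_deriv ?_
  simp only [Pi.pow_apply, Pi.mul_apply, id, vdcAmplitude]
  simp only [Nat.cast_ofNat, Nat.reduceSub, pow_one, mul_one]
  field_simp
  ring

theorem vdcAmplitude_nonneg {μ t ξ : ℝ} (hμ : 0 < μ) (ht : 0 < t) (hξ : 0 < ξ) :
    0 ≤ vdcAmplitude μ t ξ := by
  have hw := vdcWeight_pos hμ ht hξ
  have hd := disp_pos hμ hξ
  unfold vdcAmplitude
  positivity

/-- The three terms have size at most 1/ξ, 2/ξ and 1/ξ. With `vdcAmplitude_le`, the derivative of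
the amplitude is then O(ξ^{-1/2}/(1+ξ)), which is integrable on the half-line. -/
theorem abs_logDeriv_vdcAmplitude_le {μ ξ : ℝ} (hμ : 0 < μ) (hξ : 0 < ξ) :
    |groupVelocity μ ξ / disp μ ξ - 2 * ξ / (1 + ξ ^ 2) - vdcWeightLogDeriv μ ξ| ≤ 4 / ξ := by
  have hd := disp_pos hμ hξ
  have h1 : groupVelocity μ ξ / disp μ ξ ≤ 1 / ξ := by
    rw [div_le_iff₀ hd]
    refine (groupVelocity_le_div hμ hξ).trans (le_of_eq (by ring))
  have h2 : 0 ≤ groupVelocity μ ξ / disp μ ξ := div_nonneg (groupVelocity_nonneg hμ hξ) hd.le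
  have h3 : 2 * ξ / (1 + ξ ^ 2) ≤ 2 / ξ := by
    rw [div_le_div_iff₀ (by positivity) hξ]
    nlinarith
  have h4 : 0 ≤ 2 * ξ / (1 + ξ ^ 2) := by positivity
  have h5 := abs_le.1 (abs_vdcWeightLogDeriv_le hμ hξ)
  have e2 : 2 / ξ = 2 * (1 / ξ) := by ring
  have e4 : 4 / ξ = 4 * (1 / ξ) := by ring
  have h6 : 0 < 1 / ξ := by positivity
  rw [e4, abs_le]
  constructor <;> linarith [h5.1, h5.2]

theorem vdcAmplitude_le {μ t ξ : ℝ} (hμ : 0 < μ) (ht : 0 < t) (hξ : 0 < ξ) :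
    vdcAmplitude μ t ξ ≤ 16 * ((1 + √μ) / (√μ * √t)) * (√ξ / (1 + ξ)) := by
  have hm : 0 < √μ := Real.sqrt_pos.2 hμ
  have hst : 0 < √t := Real.sqrt_pos.2 ht
  have hw := vdcWeight_pos hμ ht hξ
  have hd := disp_pos hμ hξ
  have hx : 0 < √ξ := Real.sqrt_pos.2 hξ
  -- The quotient of the bound 2ξ²/(1+√μ ξ) for the square of `disp` by the square of the weight is
  -- exactly 64 ξ (1+√μ ξ)²/(μ t).
  have h1 : disp μ ξ ≤ 8 * √ξ * (1 + √μ * ξ) / (√μ * √t) * vdcWeight μ t ξ := by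
    refine (pow_le_pow_iff_left₀ hd.le (by positivity) two_ne_zero).1 ?_
    refine (disp_sq_le hμ hξ).trans (le_of_eq ?_)
    have hsq : vdcWeight μ t ξ ^ 2 = t * (√μ ^ 2 * ξ / (32 * (1 + √μ * ξ) ^ 3)) :=
      Real.sq_sqrt (by positivity)
    have e1 : √ξ ^ 2 = ξ := Real.sq_sqrt hξ.le
    have e2 : √t ^ 2 = t := Real.sq_sqrt ht.le
    rw [mul_pow, hsq, div_pow, mul_pow, mul_pow, mul_pow, e1, e2]
    field_simp
    ring
  have h2 : vdcAmplitude μ t ξ ≤ 8 * √ξ * (1 + √μ * ξ) / (√μ * √t) / (1 + ξ ^ 2) := by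
    unfold vdcAmplitude
    rw [div_le_div_iff₀ (by positivity) (by positivity)]
    nlinarith [mul_le_mul_of_nonneg_right h1 (by positivity : (0 : ℝ) ≤ 1 + ξ ^ 2)]
  refine h2.trans ?_
  have h3 : (1 + √μ * ξ) / (1 + ξ ^ 2) ≤ 2 * (1 + √μ) / (1 + ξ) := by
    rw [div_le_div_iff₀ (by positivity) (by positivity)]
    have h4 : (1 + √μ * ξ) ≤ (1 + √μ) * (1 + ξ) := by nlinarith
    have h5 : (1 + ξ) * (1 + ξ) ≤ 2 * (1 + ξ ^ 2) := by nlinarith [sq_nonneg (1 - ξ)]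
    calc (1 + √μ * ξ) * (1 + ξ) ≤ (1 + √μ) * (1 + ξ) * (1 + ξ) := by gcongr
      _ = (1 + √μ) * ((1 + ξ) * (1 + ξ)) := by ring
      _ ≤ (1 + √μ) * (2 * (1 + ξ ^ 2)) := by gcongr
      _ = _ := by ring
  calc _ = 8 * √ξ / (√μ * √t) * ((1 + √μ * ξ) / (1 + ξ ^ 2)) := by ring
    _ ≤ 8 * √ξ / (√μ * √t) * (2 * (1 + √μ) / (1 + ξ)) := by gcongr
    _ = _ := by ring

/-! ### Uniform decay of the kernel. -/

/-- The Fourier side of the convolution kernel of the propagator, after extraction of two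
derivatives. -/
noncomputable def kernelIntegrand (μ t X ξ : ℝ) : ℂ :=
  ((disp μ ξ / (1 + ξ ^ 2) : ℝ) : ℂ) * Complex.exp (Complex.I * ((X * ξ - t * disp μ ξ : ℝ) : ℂ))

theorem norm_intervalIntegral_kernelIntegrand_le {μ t : ℝ} (hμ : 0 < μ) (ht : 0 < t) (X : ℝ)
    {a b : ℝ} (ha : 0 < a) (hab : a ≤ b) :
    ‖∫ ξ in a..b, kernelIntegrand μ t X ξ‖ ≤ 1500 * ((1 + √μ) / (√μ * √t)) := by
  have hm : 0 < √μ := Real.sqrt_pos.2 hμ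
  have hst : 0 < √t := Real.sqrt_pos.2 ht
  set K := (1 + √μ) / (√μ * √t) with hK
  have hK0 : 0 < K := by positivity
  have key := norm_integral_mul_cexp_le (ψ := fun ξ ↦ X * ξ - t * disp μ ξ)
    (p := fun ξ ↦ X * 1 - t * groupVelocity μ ξ) (p' := fun ξ ↦ -(t * -dispersion μ ξ))
    (ρ := vdcWeight μ t) (ρ' := fun ξ ↦ vdcWeight μ t ξ * vdcWeightLogDeriv μ ξ)
    (B := vdcAmplitude μ t) (B' := fun ξ ↦ vdcAmplitude μ t ξ *
      (groupVelocity μ ξ / disp μ ξ - 2 * ξ / (1 + ξ ^ 2) - vdcWeightLogDeriv μ ξ))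
    -- The error terms are at most 16(4π+4)K/(√ξ(1+ξ)), whose primitive is this bounded multiple of
    -- arctan √ξ; the bound is therefore uniform in a and b.
    (R := fun ξ ↦ 32 * (4 * Real.pi + 4) * K * Real.arctan √ξ)
    (R' := fun ξ ↦ 32 * (4 * Real.pi + 4) * K * (1 / (1 + √ξ ^ 2) * (1 / (2 * √ξ))))
    (fun ξ hξ ↦ ((hasDerivAt_id ξ).const_mul X).sub ((hasDerivAt_disp hμ hξ).const_mul t))
    (fun ξ hξ ↦ ((hasDerivAt_groupVelocity hμ hξ).const_mul t).const_sub _)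
    (fun ξ hξ ↦ hasDerivAt_vdcWeight hμ ht hξ)
    (fun ξ hξ ↦ hasDerivAt_vdcAmplitude hμ ht hξ)
    (fun ξ hξ ↦ ((Real.hasDerivAt_sqrt hξ.ne').arctan).const_mul _)
    (fun ξ hξ ↦ vdcWeight_pos hμ ht hξ) (fun ξ hξ ↦ vdcAmplitude_nonneg hμ ht hξ)
    (fun ξ hξ ↦ by
      have h := le_dispersion hμ hξ
      rw [vdcWeight, Real.sq_sqrt (by positivity)]
      simp only [mul_neg, neg_neg]
      gcongr)
    (fun ξ hξ ↦ by
      have hw := vdcWeight_pos hμ ht hξ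
      have hB := vdcAmplitude_nonneg hμ ht hξ
      have hB' := vdcAmplitude_le hμ ht hξ
      have hx : 0 < √ξ := Real.sqrt_pos.2 hξ
      have h1 := abs_logDeriv_vdcAmplitude_le hμ hξ
      have h2 := abs_vdcWeightLogDeriv_le hμ hξ
      rw [mul_div_cancel_left₀ _ hw.ne', abs_mul, abs_of_nonneg hB]
      calc (Real.pi + 1 / 2) * (vdcAmplitude μ t ξ * _) + 3 / 2 * (vdcAmplitude μ t ξ * _)
          ≤ (Real.pi + 1 / 2) * (vdcAmplitude μ t ξ * (4 / ξ)) +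
            3 / 2 * (vdcAmplitude μ t ξ * (1 / ξ)) := by gcongr
        _ = (4 * Real.pi + 7 / 2) * (1 / ξ) * vdcAmplitude μ t ξ := by ring
        _ ≤ (4 * Real.pi + 4) * (1 / ξ) * (16 * K * (√ξ / (1 + ξ))) := by
          gcongr
          norm_num
        _ = _ := by
          have e1 : √ξ ^ 2 = ξ := Real.sq_sqrt hξ.le
          rw [e1]
          field_simp
          rw [e1]
          ring) ha hab
  have e : ∀ ξ ∈ Set.uIcc a b, kernelIntegrand μ t X ξ =
      ((vdcAmplitude μ t ξ * vdcWeight μ t ξ : ℝ) : ℂ) *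
      Complex.exp (Complex.I * ((X * ξ - t * disp μ ξ : ℝ) : ℂ)) := by
    intro ξ hξ
    rw [Set.uIcc_of_le hab] at hξ
    have hw := vdcWeight_pos hμ ht (ha.trans_le hξ.1)
    rw [kernelIntegrand, vdcAmplitude]
    congr 2
    field_simp
  rw [intervalIntegral.integral_congr e]
  refine key.trans ?_
  have hB : ∀ ξ, 0 < ξ → vdcAmplitude μ t ξ ≤ 8 * K := fun ξ hξ ↦ by
    refine (vdcAmplitude_le hμ ht hξ).trans ?_
    have e1 : √ξ ^ 2 = ξ := Real.sq_sqrt hξ.le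
    have : √ξ / (1 + ξ) ≤ 1 / 2 := by
      rw [div_le_div_iff₀ (by positivity) two_pos]
      nlinarith [sq_nonneg (1 - √ξ)]
    nlinarith
  have h1 := hB a ha
  have h2 := hB b (ha.trans_le hab)
  have h3 : 0 ≤ Real.arctan √a := Real.arctan_nonneg.2 (Real.sqrt_nonneg _)
  have h4 := (Real.arctan_lt_pi_div_two √b).le
  have hpi := Real.pi_pos
  have hpi2 := Real.pi_lt_d2
  have h5 : 32 * (4 * Real.pi + 4) * K * Real.arctan √b - 32 * (4 * Real.pi + 4) * K *
      Real.arctan √a ≤ 32 * (4 * Real.pi + 4) * K * (Real.pi / 2) := by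
    rw [← mul_sub]
    gcongr
    linarith
  have h6 : (Real.pi + 1 / 2) * (vdcAmplitude μ t a + vdcAmplitude μ t b) ≤
      (Real.pi + 1 / 2) * (16 * K) := by
    gcongr
    linarith
  have h7 : (Real.pi + 1 / 2) * 16 + 32 * (4 * Real.pi + 4) * (Real.pi / 2) ≤ 1500 := by nlinarith
  calc _ ≤ (Real.pi + 1 / 2) * (16 * K) + 32 * (4 * Real.pi + 4) * K * (Real.pi / 2) :=
        add_le_add h6 h5
    _ = ((Real.pi + 1 / 2) * 16 + 32 * (4 * Real.pi + 4) * (Real.pi / 2)) * K := by ring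
    _ ≤ _ := by gcongr

theorem integrable_disp_div {μ : ℝ} (hμ : 0 < μ) :
    Integrable (fun ξ : ℝ ↦ disp μ ξ / (1 + ξ ^ 2)) := by
  have hm : 0 < √μ := Real.sqrt_pos.2 hμ
  have h := (integrable_one_add_norm (E := ℝ) (μ := volume) (r := 3 / 2)
    (by simp; norm_num)).const_mul (2 / √√μ)
  refine h.mono' ((measurable_disp μ).div (by fun_prop)).aestronglyMeasurable
    (Eventually.of_forall fun ξ ↦ ?_)
  have h1 : 0 < 1 + |ξ| := by positivity
  have h2 : |disp μ ξ| ≤ √(1 + |ξ|) / √√μ := by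
    refine (abs_disp_le_sqrt hμ ξ).trans ?_
    rw [Real.sqrt_div (abs_nonneg ξ)]
    gcongr
    linarith
  have h3 : (1 + |ξ|) ^ (-(3 / 2) : ℝ) = √(1 + |ξ|) / (1 + |ξ|) ^ 2 := by
    rw [Real.sqrt_eq_rpow, ← Real.rpow_natCast, ← Real.rpow_sub h1]
    norm_num
  rw [Real.norm_eq_abs, Real.norm_eq_abs, h3, abs_div, abs_of_pos (by positivity : 0 < 1 + ξ ^ 2)]
  have h4 : (1 + |ξ|) ^ 2 ≤ 2 * (1 + ξ ^ 2) := by nlinarith [sq_nonneg (1 - |ξ|), sq_abs ξ]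
  have h5 : 1 / (1 + ξ ^ 2) ≤ 2 / (1 + |ξ|) ^ 2 := by
    rw [div_le_div_iff₀ (by positivity) (by positivity)]
    linarith
  calc |disp μ ξ| / (1 + ξ ^ 2) = |disp μ ξ| * (1 / (1 + ξ ^ 2)) := by ring
    _ ≤ √(1 + |ξ|) / √√μ * (2 / (1 + |ξ|) ^ 2) := by gcongr
    _ = _ := by ring

theorem integrable_kernelIntegrand {μ : ℝ} (hμ : 0 < μ) (t X : ℝ) :
    Integrable (kernelIntegrand μ t X) := by
  refine (integrable_disp_div hμ).ofReal.mul_bdd (c := 1) ?_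
    (Eventually.of_forall fun ξ ↦ ?_)
  · refine (Measurable.cexp ?_).aestronglyMeasurable
    exact measurable_const.mul (Complex.measurable_ofReal.comp
      ((measurable_const.mul measurable_id).sub (measurable_const.mul (measurable_disp μ))))
  · rw [mul_comm, Complex.norm_exp_ofReal_mul_I]

/-- Let a → 0 and b → ∞ on the half-line. As `disp` is odd, the integrand at -ξ is minus the
conjugate of its value at ξ, so the negative half-line only doubles the constant. -/
theorem norm_integral_kernelIntegrand_le {μ t : ℝ} (hμ : 0 < μ) (ht : 0 < t) (X : ℝ) :
    ‖∫ ξ, kernelIntegrand μ t X ξ‖ ≤ 3000 * ((1 + √μ) / (√μ * √t)) := by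
  set K := (1 + √μ) / (√μ * √t) with hK
  have hint := integrable_kernelIntegrand hμ t X
  have h1 : ∀ b, 0 < b → ‖∫ ξ in (0 : ℝ)..b, kernelIntegrand μ t X ξ‖ ≤ 1500 * K := by
    intro b hb
    have hc : Continuous fun a ↦ ∫ ξ in a..b, kernelIntegrand μ t X ξ := by
      simp_rw [intervalIntegral.integral_symm b]
      exact (intervalIntegral.continuous_primitive (fun a b ↦ hint.intervalIntegrable) b).neg
    have ht0 := (hc.tendsto 0).mono_left (nhdsWithin_le_nhds (s := Set.Ioi 0))
    refine le_of_tendsto ht0.norm ?_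
    filter_upwards [Ioo_mem_nhdsGT hb] with a ha
    exact norm_intervalIntegral_kernelIntegrand_le hμ ht X ha.1 ha.2.le
  have h2 : ‖∫ ξ in Set.Ioi 0, kernelIntegrand μ t X ξ‖ ≤ 1500 * K := by
    refine le_of_tendsto (intervalIntegral_tendsto_integral_Ioi 0 hint.integrableOn
      tendsto_id).norm ?_
    filter_upwards [eventually_gt_atTop 0] with b hb using h1 b hb
  have h3 : ∫ ξ in Set.Iic 0, kernelIntegrand μ t X ξ =
      -(starRingEnd ℂ) (∫ ξ in Set.Ioi 0, kernelIntegrand μ t X ξ) := by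
    have := integral_comp_neg_Ioi 0 (kernelIntegrand μ t X)
    rw [neg_zero] at this
    rw [← this, ← integral_conj, ← integral_neg]
    refine integral_congr_ae (Eventually.of_forall fun ξ ↦ ?_)
    simp only [kernelIntegrand, map_mul, Complex.conj_ofReal, ← Complex.exp_conj, Complex.conj_I,
      disp_neg]
    rw [show (-disp μ ξ / (1 + (-ξ) ^ 2)) = -(disp μ ξ / (1 + ξ ^ 2)) by ring,
      show X * -ξ - t * -disp μ ξ = -(X * ξ - t * disp μ ξ) by ring]
    push_cast
    ring_nf
  have h4 := intervalIntegral.integral_Iic_add_Ioi (μ := volume) (b := 0) hint.integrableOn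
    hint.integrableOn
  rw [← h4, h3]
  refine (norm_add_le _ _).trans ?_
  rw [norm_neg, RCLike.norm_conj]
  linarith

/-! ### Weak derivatives, and an L¹ bound for the second derivative. -/

/-- `g` is the distributional derivative of order `k` of `f`. -/
def IsWeakDeriv (k : ℕ) (f g : ℝ → ℂ) : Prop :=
  ∀ s : 𝓢(ℝ, ℂ), ∫ x, s x * g x = (-1) ^ k * ∫ x, ((SchwartzMap.derivCLM ℂ ℂ)^[k] s) x * f x

theorem iterate_derivCLM_apply (k : ℕ) (T : 𝓢'(ℝ, ℂ)) (s : 𝓢(ℝ, ℂ)) :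
    ((TemperedDistribution.derivCLM ℂ)^[k] T) s =
      (-1) ^ k * T ((SchwartzMap.derivCLM ℂ ℂ)^[k] s) := by
  induction k generalizing s with
  | zero => simp
  | succ k ih =>
    rw [Function.iterate_succ_apply', TemperedDistribution.derivCLM_apply_apply, map_neg, ih,
      Function.iterate_succ_apply]
    ring

theorem MemW.exists_isWeakDeriv {k : ℕ} {p : ℝ≥0∞} [Fact (1 ≤ p)] {u : ℝ → ℂ} (hu : MemW k p u)
    {j : ℕ} (hj : j ≤ k) : ∃ g : ℝ → ℂ, MemLp g p volume ∧ IsWeakDeriv j u g := by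
  obtain ⟨h, H⟩ := hu
  obtain ⟨g, hg⟩ := H j hj
  refine ⟨g, Lp.memLp g, fun s ↦ ?_⟩
  have e := congrArg (fun T : 𝓢'(ℝ, ℂ) ↦ T s) hg
  simp only [iterate_derivCLM_apply, Lp.toTemperedDistribution_apply, smul_eq_mul] at e
  rw [← e]
  congr 1
  refine integral_congr_ae ?_
  filter_upwards [h.coeFn_toLp] with x hx
  rw [hx]

theorem neg_one_pow_mul_neg_pow (a : ℂ) (k : ℕ) : (-1) ^ k * (-a) ^ k = a ^ k := by
  rw [← mul_pow, neg_one_mul, neg_neg]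

theorem fourierInv_iterate_derivCLM (k : ℕ) (s : 𝓢(ℝ, ℂ)) (ξ : ℝ) :
    (𝓕⁻ ((SchwartzMap.derivCLM ℂ ℂ)^[k] s) : 𝓢(ℝ, ℂ)) ξ =
      (-(2 * Real.pi * Complex.I * ξ)) ^ k * (𝓕⁻ s : 𝓢(ℝ, ℂ)) ξ := by
  induction k with
  | zero => simp
  | succ k ih =>
    rw [Function.iterate_succ_apply']
    set r := (SchwartzMap.derivCLM ℂ ℂ)^[k] s
    have e : SchwartzMap.derivCLM ℂ ℂ r = LineDeriv.lineDerivOp (1 : ℝ) r := by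
      ext x
      rw [SchwartzMap.derivCLM_apply, SchwartzMap.lineDerivOp_apply_eq_fderiv]
      simp
    have hT : (fun x : ℝ ↦ inner ℝ x (1 : ℝ)).HasTemperateGrowth := by fun_prop
    rw [e, SchwartzMap.fourierInv_lineDerivOp_eq, _root_.smul_apply,
      SchwartzMap.smulLeftCLM_apply_apply hT, ih]
    simp
    ring

theorem integral_mul_eq_of_L2 {f : ℝ → ℂ} (hf : MemLp f 2 volume) (s : 𝓢(ℝ, ℂ)) :
    ∫ x, s x * f x =
      ∫ ξ, (𝓕⁻ s : 𝓢(ℝ, ℂ)) ξ * (𝓕 (hf.toLp f) : Lp ℂ 2 (volume : Measure ℝ)) ξ := by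
  have e : ((hf.toLp f : Lp ℂ 2 (volume : Measure ℝ)) : 𝓢'(ℝ, ℂ)) s =
      ((𝓕 (hf.toLp f) : Lp ℂ 2 (volume : Measure ℝ)) : 𝓢'(ℝ, ℂ)) (𝓕⁻ s) := by
    rw [← Lp.fourier_toTemperedDistribution_eq, TemperedDistribution.fourier_apply,
      FourierTransform.fourier_fourierInv_eq]
  simp only [Lp.toTemperedDistribution_apply, smul_eq_mul] at e
  rw [← e]
  refine integral_congr_ae ?_
  filter_upwards [hf.coeFn_toLp] with x hx
  rw [hx]

/-- The derivative is built as the inverse transform of (2πiξ)^k times the transform of f. For k ≤ 3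
the multiplier is dominated by the H³ weight, and Plancherel gives the norm bound. -/
theorem MemH.exists_isWeakDeriv {f : ℝ → ℂ} (hf : MemH 3 f) {k : ℕ} (hk : k ≤ 3) :
    ∃ g : ℝ → ℂ, MemLp g 2 volume ∧ eLpNorm g 2 volume ≤ hNorm 3 f ∧ IsWeakDeriv k f g := by
  have hfin := hf.hNorm_lt_top (by norm_num)
  obtain ⟨h2, -⟩ := hf
  set v : Lp ℂ 2 (volume : Measure ℝ) := 𝓕 (h2.toLp f) with hv
  set w : ℝ → ℂ := fun ξ ↦ (2 * Real.pi * Complex.I * ξ) ^ k * v ξ with hw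
  have hwn : eLpNorm w 2 volume ≤ hNorm 3 f := by
    rw [hNorm, dif_pos h2]
    refine eLpNorm_mono fun ξ ↦ ?_
    rw [hw, norm_mul, norm_mul]
    refine mul_le_mul_of_nonneg_right ?_ (norm_nonneg _)
    set y := 2 * Real.pi * ξ
    have e1 : ‖(2 * Real.pi * Complex.I * ξ : ℂ)‖ = |y| := by
      rw [show (2 * Real.pi * Complex.I * ξ : ℂ) = ((y : ℝ) : ℂ) * Complex.I by
        simp [y]; ring]
      simp
    have hy : 1 ≤ 1 + y ^ 2 := by nlinarith [sq_nonneg y]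
    rw [norm_pow, e1, Complex.norm_real, Real.norm_eq_abs,
      abs_of_nonneg (by positivity : 0 ≤ (1 + y ^ 2) ^ ((3 : ℝ) / 2))]
    calc |y| ^ k ≤ √(1 + y ^ 2) ^ k := by
          gcongr
          exact Real.abs_le_sqrt (by linarith)
      _ ≤ √(1 + y ^ 2) ^ 3 := by
          gcongr
          exact Real.one_le_sqrt.2 hy
      _ = _ := by
          rw [Real.sqrt_eq_rpow, ← Real.rpow_natCast, ← Real.rpow_mul (by positivity)]
          norm_num
  have hwm : MemLp w 2 volume := by
    refine ⟨?_, hwn.trans_lt hfin⟩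
    exact (by fun_prop : Continuous fun ξ : ℝ ↦ (2 * Real.pi * Complex.I * ξ : ℂ) ^ k)
      |>.aestronglyMeasurable.mul (Lp.memLp v).1
  refine ⟨(𝓕⁻ (hwm.toLp w) : Lp ℂ 2 (volume : Measure ℝ)), Lp.memLp _, ?_, fun s ↦ ?_⟩
  · have e : ‖(𝓕⁻ (hwm.toLp w) : Lp ℂ 2 (volume : Measure ℝ))‖ = ‖hwm.toLp w‖ := by
      rw [← Lp.norm_fourier_eq, FourierTransform.fourier_fourierInv_eq]
    rw [Lp.norm_def, Lp.norm_def, ENNReal.toReal_eq_toReal_iff' (Lp.eLpNorm_ne_top _)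
      (Lp.eLpNorm_ne_top _)] at e
    rw [e, eLpNorm_congr_ae hwm.coeFn_toLp]
    exact hwn
  · rw [integral_mul_eq_of_L2 h2, integral_mul_eq_of_L2 (Lp.memLp _), Lp.toLp_coeFn,
      FourierTransform.fourier_fourierInv_eq, ← integral_const_mul]
    refine integral_congr_ae ?_
    filter_upwards [hwm.coeFn_toLp] with ξ hξ
    rw [hξ, fourierInv_iterate_derivCLM]
    simp only [hw]
    linear_combination -((𝓕⁻ s : 𝓢(ℝ, ℂ)) ξ * v ξ) *
      neg_one_pow_mul_neg_pow (2 * Real.pi * Complex.I * ξ) k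

/-- Schwartz functions include the compactly supported smooth ones. This uniqueness identifies the
L¹ derivative supplied by `MemW` with the L² derivative supplied by `MemH`. -/
theorem ae_eq_of_forall_integral_schwartz_mul_eq {f g : ℝ → ℂ} (hf : LocallyIntegrable f)
    (hg : LocallyIntegrable g) (h : ∀ s : 𝓢(ℝ, ℂ), ∫ x, s x * f x = ∫ x, s x * g x) :
    f =ᵐ[volume] g := by
  refine ae_eq_of_integral_contDiff_smul_eq hf hg fun φ φ_smooth φ_cpt ↦ ?_
  have hg₁ : HasCompactSupport (Complex.ofRealCLM ∘ φ) := φ_cpt.comp_left rfl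
  have hg₂ : ContDiff ℝ (⊤ : ℕ∞) (Complex.ofRealCLM ∘ φ) := by fun_prop
  simpa using h (hg₁.toSchwartzMap hg₂)

theorem iterate_two_derivCLM_apply (s : 𝓢(ℝ, ℂ)) (x : ℝ) :
    ((SchwartzMap.derivCLM ℂ ℂ)^[2] s) x = deriv (deriv s) x := rfl

theorem deriv_deriv_ofReal_mul (s : 𝓢(ℝ, ℂ)) (x : ℝ) :
    deriv (deriv fun y : ℝ ↦ (y : ℂ) * s y) x = x * deriv (deriv s) x + 2 * deriv s x := by
  have hd : ∀ (r : 𝓢(ℝ, ℂ)) (x : ℝ), HasDerivAt (fun y : ℝ ↦ (y : ℂ) * r y)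
      (r x + x * deriv r x) x := fun r x ↦ by
    have := ((hasDerivAt_id x).ofReal_comp).mul (r.hasDerivAt x)
    simp only [id, Complex.ofReal_one, one_mul] at this
    exact this
  have e : deriv (fun y : ℝ ↦ (y : ℂ) * s y) = fun y ↦ s y + y * deriv s y :=
    funext fun y ↦ (hd s y).deriv
  have h2 : HasDerivAt (fun y ↦ s y + y * deriv s y)
      (deriv s x + (deriv s x + x * deriv (deriv s) x)) x :=
    (s.hasDerivAt x).add (hd (SchwartzMap.derivCLM ℂ ℂ s) x)
  rw [e, h2.deriv]
  ring

/-- Integrability of the product of a Schwartz function with an `L^p` function. -/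
theorem integrable_schwartz_mul {f : ℝ → ℂ} {p : ℝ≥0∞} (hp : 1 ≤ p) (hf : MemLp f p volume)
    (s : 𝓢(ℝ, ℂ)) : Integrable (fun x ↦ s x * f x) := by
  have := ENNReal.HolderConjugate.inv_one_sub_inv' hp
  have := hf.mul (s.memLp (1 - p⁻¹)⁻¹ volume) (r := 1)
  exact memLp_one_iff_integrable.1 this

/-- This is the weak form of x f'' = (x f)'' - 2 f': test f'' against x s and use (x s)'' = x s'' +
2 s'. -/
theorem isWeakDeriv_two_ofReal_mul {f g u v : ℝ → ℂ} (hf : MemLp f 2 volume)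
    (hxf : MemLp (fun x : ℝ ↦ (x : ℂ) * f x) 2 volume)
    (hu : MemLp u 2 volume) (hv : MemLp v 2 volume) (hg : Integrable g)
    (hfg : IsWeakDeriv 2 f g) (hfu : IsWeakDeriv 1 f u)
    (hxv : IsWeakDeriv 2 (fun x : ℝ ↦ (x : ℂ) * f x) v) :
    (fun x : ℝ ↦ (x : ℂ) * g x) =ᵐ[volume] fun x ↦ v x - 2 * u x := by
  have hT : (fun x : ℝ ↦ (x : ℂ)).HasTemperateGrowth := by fun_prop
  refine ae_eq_of_forall_integral_schwartz_mul_eq ?_ ?_ fun s ↦ ?_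
  · have := hg.locallyIntegrable.locallyIntegrableOn Set.univ
    rw [← locallyIntegrableOn_univ]
    exact this.continuousOn_mul (Complex.continuous_ofReal.continuousOn) isOpen_univ.isLocallyClosed
  · exact (hv.sub (hu.const_mul 2)).locallyIntegrable one_le_two
  · have e1 := hfg (SchwartzMap.smulLeftCLM ℂ (fun x : ℝ ↦ (x : ℂ)) s)
    have e2 := hfu s
    have e3 := hxv s
    have hcoe : ⇑(SchwartzMap.smulLeftCLM ℂ (fun x : ℝ ↦ (x : ℂ)) s) =
        fun x : ℝ ↦ (x : ℂ) * s x := by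
      ext x
      rw [SchwartzMap.smulLeftCLM_apply_apply hT, smul_eq_mul]
    have e4 : ∀ x, ((SchwartzMap.derivCLM ℂ ℂ)^[2]
        (SchwartzMap.smulLeftCLM ℂ (fun x : ℝ ↦ (x : ℂ)) s)) x =
          x * ((SchwartzMap.derivCLM ℂ ℂ)^[2] s) x + 2 * ((SchwartzMap.derivCLM ℂ ℂ)^[1] s) x := by
      intro x
      rw [iterate_two_derivCLM_apply, hcoe, deriv_deriv_ofReal_mul]
      rfl
    have i1 := integrable_schwartz_mul one_le_two hxf ((SchwartzMap.derivCLM ℂ ℂ)^[2] s)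
    have i2 := integrable_schwartz_mul one_le_two hf ((SchwartzMap.derivCLM ℂ ℂ)^[1] s)
    have i3 := integrable_schwartz_mul one_le_two hv s
    have i4 := integrable_schwartz_mul one_le_two hu s
    have e5 : ∀ x, ((SchwartzMap.derivCLM ℂ ℂ)^[2]
        (SchwartzMap.smulLeftCLM ℂ (fun x : ℝ ↦ (x : ℂ)) s)) x * f x =
        ((SchwartzMap.derivCLM ℂ ℂ)^[2] s) x * (x * f x) +
          2 * (((SchwartzMap.derivCLM ℂ ℂ)^[1] s) x * f x) := fun x ↦ by
      rw [e4]
      ring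
    have e6 : ∫ x, s x * (v x - 2 * u x) = (∫ x, s x * v x) - 2 * ∫ x, s x * u x := by
      rw [← integral_const_mul, ← integral_sub i3 (i4.const_mul 2)]
      congr 1
      ext x
      ring
    simp_rw [e5] at e1
    rw [integral_add i1 (i2.const_mul 2), integral_const_mul] at e1
    rw [e6, e3, e2]
    rw [show ∫ x, s x * (x * g x) =
        ∫ x, (SchwartzMap.smulLeftCLM ℂ (fun x : ℝ ↦ (x : ℂ)) s) x * g x by
      congr 1
      ext x
      rw [hcoe]
      ring, e1]
    ring

/-- A weighted `L²` bound controls the `L¹` norm. -/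
theorem exists_eLpNorm_one_le : ∃ C : ℝ, 0 < C ∧ ∀ g : ℝ → ℂ, AEStronglyMeasurable g volume →
    eLpNorm g 1 volume ≤ ENNReal.ofReal C *
      (eLpNorm g 2 volume + eLpNorm (fun x : ℝ ↦ (x : ℂ) * g x) 2 volume) := by
  -- Hölder's inequality with the L² weight 1/(1+|x|) against (1+|x|)|g|.
  set w : ℝ → ℝ := fun x ↦ (1 + ‖x‖) ^ (-1 : ℝ) with hw
  have hwc : Continuous w := Continuous.rpow_const (by fun_prop) fun x ↦ Or.inl (by positivity)
  have hwm : MemLp w 2 volume := by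
    rw [memLp_two_iff_integrable_sq hwc.aestronglyMeasurable]
    have := integrable_one_add_norm (E := ℝ) (μ := volume) (r := 2) (by simp)
    refine this.congr (Eventually.of_forall fun x ↦ ?_)
    simp only [hw]
    rw [← Real.rpow_mul_natCast (by positivity)]
    norm_num
  refine ⟨(eLpNorm w 2 volume).toReal + 1, by positivity, fun g hg ↦ ?_⟩
  have hC : eLpNorm w 2 volume ≤ ENNReal.ofReal ((eLpNorm w 2 volume).toReal + 1) := by
    rw [ENNReal.le_ofReal_iff_toReal_le hwm.2.ne (by positivity)]
    linarith
  have hxg : AEStronglyMeasurable (fun x : ℝ ↦ (x : ℂ) * g x) volume :=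
    Complex.continuous_ofReal.aestronglyMeasurable.mul hg
  set G : ℝ → ℝ := fun x ↦ ‖g x‖ + ‖(x : ℂ) * g x‖ with hG
  have e : eLpNorm g 1 volume = eLpNorm (w • G) 1 volume := by
    refine eLpNorm_congr_norm_ae (Eventually.of_forall fun x ↦ ?_)
    simp only [hw, hG, Pi.smul_apply', smul_eq_mul, norm_mul, Complex.norm_real]
    have : 0 < 1 + ‖x‖ := by positivity
    rw [Real.rpow_neg_one, show ‖g x‖ + ‖x‖ * ‖g x‖ = (1 + ‖x‖) * ‖g x‖ by ring, norm_mul,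
      norm_norm, norm_inv, Real.norm_of_nonneg this.le]
    field_simp
  rw [e]
  refine (eLpNorm_smul_le_mul_eLpNorm (p := 2) (q := 2) (hg.norm.add hxg.norm)
    hwc.aestronglyMeasurable).trans (mul_le_mul' hC ?_)
  refine (eLpNorm_add_le hg.norm hxg.norm one_le_two).trans (le_of_eq ?_)
  rw [eLpNorm_norm, eLpNorm_norm]

theorem exists_eLpNorm_one_weakDeriv_le : ∃ C : ℝ, 0 < C ∧ ∀ f g : ℝ → ℂ, MemH 3 f →
    MemH 3 (fun x : ℝ ↦ (x : ℂ) * f x) → Integrable g → IsWeakDeriv 2 f g →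
    eLpNorm g 1 volume ≤ ENNReal.ofReal C *
      (hNorm 3 f + hNorm 3 (fun x : ℝ ↦ (x : ℂ) * f x)) := by
  obtain ⟨C, hC, H⟩ := exists_eLpNorm_one_le
  refine ⟨C * 3, by positivity, fun f g hf hxf hg hfg ↦ ?_⟩
  obtain ⟨u, hu, hun, hfu⟩ := hf.exists_isWeakDeriv (k := 1) (by norm_num)
  obtain ⟨u₂, hu₂, hu₂n, hfu₂⟩ := hf.exists_isWeakDeriv (k := 2) (by norm_num)
  obtain ⟨v, hv, hvn, hxv⟩ := hxf.exists_isWeakDeriv (k := 2) (by norm_num)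
  have e1 : g =ᵐ[volume] u₂ := ae_eq_of_forall_integral_schwartz_mul_eq hg.locallyIntegrable
    (hu₂.locallyIntegrable one_le_two) fun s ↦ by rw [hfg s, hfu₂ s]
  have e2 := isWeakDeriv_two_ofReal_mul hf.1 hxf.1 hu hv hg hfg hfu hxv
  refine (H g hg.1).trans ?_
  rw [eLpNorm_congr_ae e1, eLpNorm_congr_ae e2, ENNReal.ofReal_mul hC.le, mul_assoc]
  gcongr
  have h2 : eLpNorm (fun x ↦ 2 * u x) 2 volume ≤ 2 * hNorm 3 f := by
    have : (fun x ↦ 2 * u x) = (2 : ℂ) • u := rfl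
    rw [this, eLpNorm_const_smul]
    refine mul_le_mul' (le_of_eq ?_) hun
    rw [enorm_eq_nnnorm]
    norm_num
  have h3 := eLpNorm_sub_le (μ := volume) (p := 2) hv.1 (hu.const_mul 2).1 one_le_two
  calc _ ≤ hNorm 3 f + (hNorm 3 (fun x : ℝ ↦ (x : ℂ) * f x) + 2 * hNorm 3 f) := by
        refine add_le_add hu₂n (h3.trans (add_le_add hvn h2))
    _ = 3 * hNorm 3 f + hNorm 3 (fun x : ℝ ↦ (x : ℂ) * f x) := by ring
    _ ≤ 3 * hNorm 3 f + 3 * hNorm 3 (fun x : ℝ ↦ (x : ℂ) * f x) := by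
        gcongr
        exact le_mul_of_one_le_left' (by norm_num)
    _ = _ := by
        rw [mul_add]
        norm_num

/-! ### Fourier transforms of integrable functions and the convolution form of the integral. -/

theorem continuous_fourier_of_integrable {f : ℝ → ℂ} (hf : Integrable f) : Continuous (𝓕 f) :=
  VectorFourier.fourierIntegral_continuous Real.continuous_fourierChar continuous_inner hf

theorem integral_fourier_mul_eq_of_integrable {f g : ℝ → ℂ} (hf : Integrable f)
    (hg : Integrable g) : ∫ ξ, 𝓕 f ξ * g ξ = ∫ x, f x * 𝓕 g x := by
  simpa using! VectorFourier.integral_fourierIntegral_smul_eq_flip (L := innerₗ ℝ)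
    Real.continuous_fourierChar continuous_inner hf hg

/-- Testing the transform of g against s is testing g against the transform of s, where
differentiation becomes multiplication. Continuity of both sides upgrades the almost everywhere
identity to every ξ. -/
theorem fourier_isWeakDeriv {k : ℕ} {f g : ℝ → ℂ} (hf : Integrable f) (hg : Integrable g)
    (h : IsWeakDeriv k f g) (ξ : ℝ) : 𝓕 g ξ = (2 * Real.pi * Complex.I * ξ) ^ k * 𝓕 f ξ := by
  have hcf := continuous_fourier_of_integrable hf
  have hcg := continuous_fourier_of_integrable hg
  have hc : Continuous fun ξ : ℝ ↦ (2 * Real.pi * Complex.I * ξ) ^ k * 𝓕 f ξ := by fun_prop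
  refine congrFun ((Continuous.ae_eq_iff_eq volume hcg hc).1
    (ae_eq_of_forall_integral_schwartz_mul_eq hcg.locallyIntegrable hc.locallyIntegrable
      fun s ↦ ?_)) ξ
  have e1 := h (𝓕 s)
  set r := (SchwartzMap.derivCLM ℂ ℂ)^[k] (𝓕 s)
  have e2 : ∫ x, r x * f x = ∫ x, (𝓕⁻ r : 𝓢(ℝ, ℂ)) x * 𝓕 f x := by
    have := integral_fourier_mul_eq_of_integrable (𝓕⁻ r).integrable hf
    rw [← SchwartzMap.fourier_coe, FourierTransform.fourier_fourierInv_eq] at this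
    exact this
  have e3 : ∫ x, (𝓕 s) x * g x = ∫ x, s x * 𝓕 g x :=
    integral_fourier_mul_eq_of_integrable s.integrable hg
  rw [← e3, e1, e2, ← integral_const_mul]
  congr 1
  ext x
  rw [fourierInv_iterate_derivCLM, FourierTransform.fourierInv_fourier_eq]
  linear_combination (s x * 𝓕 f x) * neg_one_pow_mul_neg_pow (2 * Real.pi * Complex.I * x) k

theorem hat_eq_fourier (u : ℝ → ℂ) (ξ : ℝ) :
    hat u ξ = ((2 * Real.pi : ℝ) : ℂ)⁻¹ * 𝓕 u (ξ / (2 * Real.pi)) := by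
  rw [hat, Real.fourier_eq']
  congr 2
  ext X
  rw [smul_eq_mul]
  congr 2
  have : (Real.pi : ℂ) ≠ 0 := Complex.ofReal_ne_zero.2 Real.pi_ne_zero
  simp
  field_simp

theorem continuous_hat {u : ℝ → ℂ} (hu : Integrable u) : Continuous (hat u) := by
  have h := continuous_fourier_of_integrable hu
  have e : hat u = fun ξ ↦ ((2 * Real.pi : ℝ) : ℂ)⁻¹ * 𝓕 u (ξ / (2 * Real.pi)) :=
    funext (hat_eq_fourier u)
  rw [e]
  fun_prop

theorem norm_exp_neg_I_mul (X ξ : ℝ) : ‖Complex.exp (-(Complex.I * X * ξ))‖ = 1 := by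
  rw [show -(Complex.I * X * ξ) = ((-(X * ξ) : ℝ) : ℂ) * Complex.I by push_cast; ring,
    Complex.norm_exp_ofReal_mul_I]

theorem norm_hat_le (u : ℝ → ℂ) (ξ : ℝ) : ‖hat u ξ‖ ≤ (2 * Real.pi)⁻¹ * ∫ X, ‖u X‖ := by
  rw [hat, norm_mul, norm_inv, Complex.norm_real, Real.norm_of_nonneg (by positivity)]
  gcongr
  refine (norm_integral_le_integral_norm _).trans (le_of_eq ?_)
  congr 1
  ext X
  rw [norm_mul, norm_exp_neg_I_mul, one_mul]

theorem hat_sub_isWeakDeriv_two {f g : ℝ → ℂ} (hf : Integrable f) (hg : Integrable g)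
    (h : IsWeakDeriv 2 f g) (ξ : ℝ) : hat (fun X ↦ f X - g X) ξ = (1 + ξ ^ 2) * hat f ξ := by
  have e1 : hat (fun X ↦ f X - g X) ξ = hat f ξ - hat g ξ := by
    have hb : ∀ {u : ℝ → ℂ}, Integrable u →
        Integrable fun X : ℝ ↦ Complex.exp (-(Complex.I * X * ξ)) * u X := fun hu ↦
      hu.bdd_mul (c := 1) (by fun_prop : Continuous fun X : ℝ ↦
        Complex.exp (-(Complex.I * X * ξ))).aestronglyMeasurable
        (Eventually.of_forall fun X ↦ (norm_exp_neg_I_mul X ξ).le)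
    simp only [hat, mul_sub]
    rw [integral_sub (hb hf) (hb hg), mul_sub]
  have hpi : (Real.pi : ℂ) ≠ 0 := Complex.ofReal_ne_zero.2 Real.pi_ne_zero
  rw [e1, hat_eq_fourier f, hat_eq_fourier g, fourier_isWeakDeriv hf hg h]
  push_cast
  field_simp
  rw [Complex.I_sq]
  ring

theorem zetaIntegrand_eq {μ t X ξ : ℝ} {f g : ℝ → ℂ} (hf : Integrable f) (hg : Integrable g)
    (h : IsWeakDeriv 2 f g) : zetaIntegrand μ f t X ξ =
      kernelIntegrand μ t X ξ * hat (fun X ↦ f X - g X) ξ := by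
  have h1 : (1 + (ξ : ℂ) ^ 2) ≠ 0 := by
    have : (1 + ξ ^ 2 : ℝ) ≠ 0 := by positivity
    exact_mod_cast this
  rw [hat_sub_isWeakDeriv_two hf hg h, zetaIntegrand, kernelIntegrand, mul_assoc,
    ← Complex.exp_add]
  push_cast
  rw [show -(Complex.I * t * disp μ ξ) + Complex.I * X * ξ =
    Complex.I * (X * ξ - t * disp μ ξ) by ring]
  field_simp

theorem integrable_kernelIntegrand_mul_hat {μ : ℝ} (hμ : 0 < μ) (t X : ℝ) {q : ℝ → ℂ}
    (hq : Integrable q) : Integrable fun ξ ↦ kernelIntegrand μ t X ξ * hat q ξ :=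
  (integrable_kernelIntegrand hμ t X).mul_bdd (continuous_hat hq).aestronglyMeasurable
    (Eventually.of_forall (norm_hat_le q))

/-- Fubini: the factor 1/(1+ξ²) makes the kernel integrand absolutely integrable, and e^{-iYξ}
translates X to X - Y. -/
theorem integral_kernelIntegrand_mul_hat {μ : ℝ} (hμ : 0 < μ) (t X : ℝ) {q : ℝ → ℂ}
    (hq : Integrable q) : ∫ ξ, kernelIntegrand μ t X ξ * hat q ξ =
      ((2 * Real.pi : ℝ) : ℂ)⁻¹ * ∫ Y, q Y * ∫ ξ, kernelIntegrand μ t (X - Y) ξ := by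
  have hi : Integrable (fun z : ℝ × ℝ ↦ kernelIntegrand μ t X z.1 *
      (Complex.exp (-(Complex.I * z.2 * z.1)) * q z.2)) (volume.prod volume) := by
    have h := ((integrable_kernelIntegrand hμ t X).mul_prod hq).bdd_mul (c := 1)
      (by fun_prop : Continuous fun z : ℝ × ℝ ↦
        Complex.exp (-(Complex.I * z.2 * z.1))).aestronglyMeasurable
        (Eventually.of_forall fun z ↦ (norm_exp_neg_I_mul z.2 z.1).le)
    refine h.congr (Eventually.of_forall fun z ↦ ?_)
    ring
  calc _ = ∫ ξ, ((2 * Real.pi : ℝ) : ℂ)⁻¹ * ∫ Y : ℝ, kernelIntegrand μ t X ξ *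
        (Complex.exp (-(Complex.I * Y * ξ)) * q Y) := by
        congr 1
        ext ξ
        rw [hat, integral_const_mul]
        ring
    _ = ((2 * Real.pi : ℝ) : ℂ)⁻¹ * ∫ Y : ℝ, ∫ ξ : ℝ, kernelIntegrand μ t X ξ *
        (Complex.exp (-(Complex.I * Y * ξ)) * q Y) := by
        rw [integral_const_mul]
        congr 1
        exact integral_integral_swap hi
    _ = _ := by
        congr 2
        ext Y
        rw [← integral_const_mul]
        congr 1
        ext ξ
        rw [kernelIntegrand, kernelIntegrand, show Complex.exp (Complex.I *
          (((X - Y) * ξ - t * disp μ ξ : ℝ) : ℂ)) = Complex.exp (Complex.I *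
          ((X * ξ - t * disp μ ξ : ℝ) : ℂ)) * Complex.exp (-(Complex.I * Y * ξ)) by
            rw [← Complex.exp_add]
            congr 1
            push_cast
            ring]
        ring

theorem norm_integral_kernelIntegrand_mul_hat_le {μ t : ℝ} (hμ : 0 < μ) (ht : 0 < t) (X : ℝ)
    {q : ℝ → ℂ} (hq : Integrable q) : ‖∫ ξ, kernelIntegrand μ t X ξ * hat q ξ‖ ≤
      3000 * ((1 + √μ) / (√μ * √t)) * ∫ Y, ‖q Y‖ := by
  rw [integral_kernelIntegrand_mul_hat hμ t X hq, norm_mul]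
  have h1 : ‖((2 * Real.pi : ℝ) : ℂ)⁻¹‖ ≤ 1 := by
    rw [norm_inv, Complex.norm_real, Real.norm_of_nonneg (by positivity)]
    exact inv_le_one_of_one_le₀ (by linarith [Real.pi_gt_three])
  have h2 : ‖∫ Y, q Y * ∫ ξ, kernelIntegrand μ t (X - Y) ξ‖ ≤
      ∫ Y, ‖q Y‖ * (3000 * ((1 + √μ) / (√μ * √t))) := by
    refine norm_integral_le_of_norm_le (hq.norm.mul_const _) (Eventually.of_forall fun Y ↦ ?_)
    rw [norm_mul]
    gcongr
    exact norm_integral_kernelIntegrand_le hμ ht _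
  rw [integral_mul_const] at h2
  calc _ ≤ 1 * ‖∫ Y, q Y * ∫ ξ, kernelIntegrand μ t (X - Y) ξ‖ := by gcongr
    _ ≤ _ := by
      rw [one_mul, mul_comm]
      exact h2.trans (le_of_eq (by ring))

/-! ### Resonance formula and the upper bound. -/

/-- The phases of the pressure and of the propagator multiply to e^{-itφ(ξ)}, independent of τ, so
the time integral contributes exactly t. -/
theorem zetaR_eq_integral_rightGoingHat (μ : ℝ) (P₀ : ℝ → ℂ) (t X : ℝ) :
    zetaR μ P₀ t X = ∫ ξ : ℝ, rightGoingHat μ (resonantPressureHat μ P₀) t ξ *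
      Complex.exp (Complex.I * X * ξ) := by
  rw [zetaR, ← integral_const_mul]
  congr 1
  ext ξ
  have e : ∀ τ : ℝ, (disp μ ξ : ℂ) * resonantPressureHat μ P₀ τ ξ *
      Complex.exp (Complex.I * (τ - t) * disp μ ξ) =
      disp μ ξ * hat P₀ ξ * Complex.exp (-(Complex.I * t * disp μ ξ)) := fun τ ↦ by
    rw [resonantPressureHat, show -(Complex.I * t * disp μ ξ) = -(Complex.I * τ * disp μ ξ) +
      Complex.I * (τ - t) * disp μ ξ by ring, Complex.exp_add]
    ring
  simp only [rightGoingHat, e]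
  rw [intervalIntegral.integral_const, Complex.real_smul, zetaIntegrand]
  push_cast
  ring

theorem zetaR_zero (μ : ℝ) (P₀ : ℝ → ℂ) (X : ℝ) : zetaR μ P₀ 0 X = 0 := by
  simp [zetaR]

theorem norm_zetaR_le {μ t : ℝ} (hμ : 0 < μ) (ht : 0 ≤ t) (X : ℝ) {f g : ℝ → ℂ}
    (hf : Integrable f) (hg : Integrable g) (h : IsWeakDeriv 2 f g) :
    ‖zetaR μ f t X‖ ≤ 3000 * (1 + √μ) * √(t / μ) * ∫ Y, ‖f Y - g Y‖ := by
  rcases ht.eq_or_lt with rfl | ht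
  · rw [zetaR_zero]
    simp
  have hm : 0 < √μ := Real.sqrt_pos.2 hμ
  have hst : 0 < √t := Real.sqrt_pos.2 ht
  have h1 := norm_integral_kernelIntegrand_mul_hat_le hμ ht X (hf.sub hg)
  have h2 : ‖-(Complex.I * t / 2)‖ = t / 2 := by
    simp [abs_of_pos ht]
  have hI : 0 ≤ ∫ Y, ‖f Y - g Y‖ := by positivity
  simp only [zetaR]
  simp_rw [zetaIntegrand_eq hf hg h]
  rw [norm_mul, h2]
  calc _ ≤ t / 2 * (3000 * ((1 + √μ) / (√μ * √t)) * ∫ Y, ‖f Y - g Y‖) := by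
        gcongr
        exact h1
    _ = 1500 * (1 + √μ) * √(t / μ) * ∫ Y, ‖f Y - g Y‖ := by
        rw [Real.sqrt_div ht.le]
        field_simp
        rw [Real.sq_sqrt ht.le]
        ring
    _ ≤ _ := by
        gcongr
        norm_num

theorem exists_amplification_upper_bound (μmax : ℝ) : ∃ C : ℝ, 0 < C ∧ ∀ P₀ : ℝ → ℂ,
    MemH 3 P₀ → MemW 2 1 P₀ → MemH 3 (fun X : ℝ ↦ (X : ℂ) * P₀ X) →
    ∀ μ : ℝ, 0 < μ → μ ≤ μmax → ∀ t : ℝ, 0 ≤ t →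
      (∀ X : ℝ, Integrable (zetaIntegrand μ P₀ t X) volume) ∧
      eLpNorm (zetaR μ P₀ t) ∞ volume ≤ ENNReal.ofReal (C * Real.sqrt (t / μ)) *
        (hNorm 3 P₀ + eLpNorm P₀ 1 volume + hNorm 3 (fun X : ℝ ↦ (X : ℂ) * P₀ X)) := by
  obtain ⟨C, hC, H⟩ := exists_eLpNorm_one_weakDeriv_le
  refine ⟨3000 * (1 + √μmax) * (1 + C), by positivity, fun P₀ hP hW hXP μ hμ hμm t ht ↦ ?_⟩
  obtain ⟨g, hg, hPg⟩ := hW.exists_isWeakDeriv le_rfl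
  have hP1 : Integrable P₀ := memLp_one_iff_integrable.1 hW.1
  have hg1 : Integrable g := memLp_one_iff_integrable.1 hg
  refine ⟨fun X ↦ ?_, ?_⟩
  · refine (integrable_kernelIntegrand_mul_hat hμ t X (hP1.sub hg1)).congr
      (Eventually.of_forall fun ξ ↦ ?_)
    exact (zetaIntegrand_eq hP1 hg1 hPg).symm
  · have hL1 : eLpNorm (P₀ - g) 1 volume ≤ ENNReal.ofReal (1 + C) *
        (hNorm 3 P₀ + eLpNorm P₀ 1 volume + hNorm 3 (fun X : ℝ ↦ (X : ℂ) * P₀ X)) := by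
      refine (eLpNorm_sub_le hP1.1 hg1.1 le_rfl).trans ?_
      refine (add_le_add le_rfl (H P₀ g hP hXP hg1 hPg)).trans ?_
      rw [ENNReal.ofReal_add zero_le_one hC.le, ENNReal.ofReal_one, add_mul, one_mul]
      gcongr
      · exact le_add_right le_add_self
      · exact le_self_add
    rw [eLpNorm_exponent_top]
    refine eLpNormEssSup_le_of_ae_enorm_bound (Eventually.of_forall fun X ↦ ?_)
    have hb := norm_zetaR_le hμ ht X hP1 hg1 hPg
    have hI : ENNReal.ofReal (∫ Y, ‖P₀ Y - g Y‖) = eLpNorm (P₀ - g) 1 volume := by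
      rw [eLpNorm_one_eq_lintegral_enorm]
      exact ofReal_integral_norm_eq_lintegral_enorm (hP1.sub hg1)
    rw [← ofReal_norm]
    refine (ENNReal.ofReal_le_ofReal hb).trans ?_
    rw [ENNReal.ofReal_mul (by positivity), hI]
    refine (mul_le_mul' le_rfl hL1).trans ?_
    rw [← mul_assoc, ← ENNReal.ofReal_mul (by positivity)]
    gcongr ENNReal.ofReal ?_ * _
    calc 3000 * (1 + √μ) * √(t / μ) * (1 + C) ≤ 3000 * (1 + √μmax) * √(t / μ) * (1 + C) := by
          gcongr
      _ = _ := by ring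

/-! ### Wave packets with L¹ norm of order √t. -/

theorem integral_norm_sq_fourierInv (s : 𝓢(ℝ, ℂ)) :
    ∫ v, ‖(𝓕⁻ s : 𝓢(ℝ, ℂ)) v‖ ^ 2 = ∫ x, ‖s x‖ ^ 2 := by
  rw [← SchwartzMap.integral_norm_sq_fourier, FourierTransform.fourier_fourierInv_eq]

theorem SchwartzMap.integrable_norm_sq (s : 𝓢(ℝ, ℂ)) : Integrable fun x ↦ ‖s x‖ ^ 2 :=
  (s.memLp 2).integrable_norm_pow two_ne_zero

/-- The `L¹` norm of a Fourier transform is controlled by weighted `L²` norms. -/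
theorem integral_norm_fourierInv_le (s : 𝓢(ℝ, ℂ)) {t κ : ℝ} (ht : 0 < t) (hκ : 0 < κ) :
    ∫ v, ‖(𝓕⁻ s : 𝓢(ℝ, ℂ)) v‖ ≤ (κ / t * Real.pi +
      (t ^ 2 * (∫ x, ‖s x‖ ^ 2) + ∫ x, ‖deriv s x‖ ^ 2) / κ) / 2 := by
  set r : 𝓢(ℝ, ℂ) := 𝓕⁻ s with hr
  set r₁ : 𝓢(ℝ, ℂ) := 𝓕⁻ (SchwartzMap.derivCLM ℂ ℂ s) with hr₁
  have h1 : ∀ v, v ^ 2 * ‖r v‖ ^ 2 ≤ ‖r₁ v‖ ^ 2 := fun v ↦ by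
    have := fourierInv_iterate_derivCLM 1 s v
    rw [Function.iterate_one, pow_one] at this
    rw [hr₁, this, norm_mul, norm_neg, mul_pow]
    refine mul_le_mul_of_nonneg_right ?_ (sq_nonneg _)
    rw [show (2 * Real.pi * Complex.I * v : ℂ) = ((2 * Real.pi * v : ℝ) : ℂ) * Complex.I by
      push_cast; ring, norm_mul, Complex.norm_I, mul_one, Complex.norm_real, Real.norm_eq_abs,
      sq_abs, mul_pow]
    have : 1 ≤ 2 * Real.pi := by linarith [Real.pi_gt_three]
    exact le_mul_of_one_le_left (sq_nonneg v) (one_le_pow₀ this)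
  -- Arithmetic–geometric mean inequality with weight t² + v²: a linearised Cauchy–Schwarz, with κ
  -- left free to be optimised.
  have h2 : ∀ v, ‖r v‖ ≤ (κ / t ^ 2 * (1 + (v / t) ^ 2)⁻¹ +
      (t ^ 2 * ‖r v‖ ^ 2 + ‖r₁ v‖ ^ 2) / κ) / 2 := fun v ↦ by
    have hw : 0 < t ^ 2 + v ^ 2 := by positivity
    have e1 : κ / t ^ 2 * (1 + (v / t) ^ 2)⁻¹ = κ / (t ^ 2 + v ^ 2) := by
      field_simp
    have h3 : (t ^ 2 + v ^ 2) * ‖r v‖ ^ 2 / κ ≤ (t ^ 2 * ‖r v‖ ^ 2 + ‖r₁ v‖ ^ 2) / κ := by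
      gcongr
      linarith [h1 v]
    have h4 : 2 * ‖r v‖ ≤ κ / (t ^ 2 + v ^ 2) + (t ^ 2 + v ^ 2) * ‖r v‖ ^ 2 / κ := by
      have h5 := sq_nonneg (κ - (t ^ 2 + v ^ 2) * ‖r v‖)
      have e : κ / (t ^ 2 + v ^ 2) + (t ^ 2 + v ^ 2) * ‖r v‖ ^ 2 / κ - 2 * ‖r v‖ =
          (κ - (t ^ 2 + v ^ 2) * ‖r v‖) ^ 2 / (κ * (t ^ 2 + v ^ 2)) := by
        field_simp
        ring
      have : 0 ≤ (κ - (t ^ 2 + v ^ 2) * ‖r v‖) ^ 2 / (κ * (t ^ 2 + v ^ 2)) := by positivity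
      linarith
    rw [e1]
    linarith
  have hi1 : Integrable fun v : ℝ ↦ κ / t ^ 2 * (1 + (v / t) ^ 2)⁻¹ :=
    (integrable_inv_one_add_sq.comp_div ht.ne').const_mul _
  have hi2 : Integrable fun v : ℝ ↦ (t ^ 2 * ‖r v‖ ^ 2 + ‖r₁ v‖ ^ 2) / κ :=
    ((r.integrable_norm_sq.const_mul _).add r₁.integrable_norm_sq).div_const _
  refine (integral_mono r.integrable.norm ((hi1.add hi2).div_const 2) h2).trans (le_of_eq ?_)
  simp only [Pi.add_apply]
  rw [integral_div, integral_add hi1 hi2, integral_const_mul,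
    Measure.integral_comp_div (fun x ↦ (1 + x ^ 2)⁻¹) t, integral_univ_inv_one_add_sq, integral_div,
    integral_add (r.integrable_norm_sq.const_mul _) r₁.integrable_norm_sq, integral_const_mul,
    integral_norm_sq_fourierInv, integral_norm_sq_fourierInv, abs_of_pos ht, smul_eq_mul]
  congr 2
  field_simp

/-- If the transform vanished off the null set {0}, then u would vanish almost everywhere by
duality. A nonzero frequency is wanted because β must be supported away from 0. -/
theorem exists_hat_ne_zero {u : ℝ → ℂ} (hu : Integrable u) (h : ¬ u =ᵐ[volume] 0) :
    ∃ ξ : ℝ, ξ ≠ 0 ∧ hat u ξ ≠ 0 := by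
  by_contra! H
  refine h (ae_eq_of_forall_integral_schwartz_mul_eq hu.locallyIntegrable
    (integrable_zero ℝ ℂ volume).locallyIntegrable fun s ↦ ?_)
  have h1 : 𝓕 u =ᵐ[volume] 0 := by
    have h0 : ∀ᵐ y : ℝ, y ≠ 0 := Measure.ae_ne volume 0
    filter_upwards [h0] with y hy
    have h2 := H (2 * Real.pi * y) (by have := Real.pi_pos; positivity)
    rw [hat_eq_fourier, mul_div_cancel_left₀ y (by have := Real.pi_pos; positivity)] at h2
    refine (mul_eq_zero.1 h2).resolve_left (inv_ne_zero ?_)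
    exact Complex.ofReal_ne_zero.2 (by have := Real.pi_pos; positivity)
  have h2 := integral_fourier_mul_eq_of_integrable (𝓕⁻ s).integrable hu
  rw [← SchwartzMap.fourier_coe, FourierTransform.fourier_fourierInv_eq] at h2
  rw [h2]
  simp only [Pi.zero_apply, mul_zero, integral_zero]
  rw [← integral_zero ℝ ℂ]
  refine integral_congr_ae ?_
  filter_upwards [h1] with y hy
  rw [hy, Pi.zero_apply, mul_zero]

theorem contDiffAt_disp {μ ξ : ℝ} (hμ : 0 < μ) (hξ : ξ ≠ 0) :
    ContDiffAt ℝ (⊤ : ℕ∞) (disp μ) ξ := by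
  have hm : 0 < √μ := Real.sqrt_pos.2 hμ
  have h1 : ContDiffAt ℝ (⊤ : ℕ∞)
      (fun ξ : ℝ ↦ ξ * √(Real.tanh (√μ * ξ) / (√μ * ξ))) ξ := by
    have hx : √μ * ξ ≠ 0 := mul_ne_zero hm.ne' hξ
    have hlin : ContDiffAt ℝ (⊤ : ℕ∞) (fun ξ : ℝ ↦ √μ * ξ) ξ := by fun_prop
    refine contDiffAt_id.mul (((contDiff_tanh.contDiffAt.comp ξ hlin).div hlin hx).sqrt ?_)
    refine div_ne_zero (fun h0 ↦ hx ?_) hx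
    exact Real.tanh_injective (h0.trans Real.tanh_zero.symm)
  refine h1.congr_of_eventuallyEq ?_
  filter_upwards [isOpen_ne.mem_nhds hξ] with y hy
  rw [disp, waveOmega, if_neg (mul_ne_zero hm.ne' hy)]

theorem abs_deriv_disp_le_one {μ ξ : ℝ} (hμ : 0 < μ) (hξ : ξ ≠ 0) : |deriv (disp μ) ξ| ≤ 1 := by
  have key : ∀ y, 0 < y → |deriv (disp μ) y| ≤ 1 := fun y hy ↦ by
    rw [(hasDerivAt_disp hμ hy).deriv, abs_of_nonneg (groupVelocity_nonneg hμ hy)]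
    exact groupVelocity_le_one hμ hy
  rcases lt_or_gt_of_ne hξ with h | h
  · have e : deriv (disp μ) (-ξ) = deriv (disp μ) ξ := by
      have h1 := deriv_comp_neg (disp μ) ξ
      simp only [disp_neg] at h1
      rw [deriv.fun_neg] at h1
      linarith
    rw [← e]
    exact key _ (neg_pos.2 h)
  · exact key ξ h

theorem contDiff_mul_cexp_disp {μ : ℝ} (hμ : 0 < μ) (t : ℝ) {β : ℝ → ℂ}
    (hβ : ContDiff ℝ (⊤ : ℕ∞) β) (h0 : (0 : ℝ) ∉ tsupport β) :
    ContDiff ℝ (⊤ : ℕ∞) fun ξ ↦ β ξ * Complex.exp (Complex.I * ((t * disp μ ξ : ℝ) : ℂ)) := by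
  rw [contDiff_iff_contDiffAt]
  intro ξ
  by_cases hξ : ξ = 0
  · subst hξ
    have : (fun ξ ↦ β ξ * Complex.exp (Complex.I * ((t * disp μ ξ : ℝ) : ℂ))) =ᶠ[nhds 0]
        fun _ ↦ 0 := by
      filter_upwards [notMem_tsupport_iff_eventuallyEq.1 h0] with y hy
      rw [hy, Pi.zero_apply, zero_mul]
    exact contDiffAt_const.congr_of_eventuallyEq this
  · have h1 := (contDiffAt_const (c := t)).mul (contDiffAt_disp hμ hξ)
    have h2 : ContDiffAt ℝ (⊤ : ℕ∞) (fun ξ ↦ ((t * disp μ ξ : ℝ) : ℂ)) ξ :=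
      Complex.ofRealCLM.contDiff.contDiffAt.comp ξ h1
    exact hβ.contDiffAt.mul (contDiffAt_const.mul h2).cexp

theorem norm_deriv_mul_cexp_disp_le {μ t : ℝ} (hμ : 0 < μ) (ht : 0 ≤ t) {β : ℝ → ℂ}
    (hβ : ContDiff ℝ (⊤ : ℕ∞) β) (h0 : (0 : ℝ) ∉ tsupport β) (ξ : ℝ) :
    ‖deriv (fun ξ ↦ β ξ * Complex.exp (Complex.I * ((t * disp μ ξ : ℝ) : ℂ))) ξ‖ ≤
      ‖deriv β ξ‖ + t * ‖β ξ‖ := by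
  by_cases hξ : ξ = 0
  · subst hξ
    have : (fun ξ ↦ β ξ * Complex.exp (Complex.I * ((t * disp μ ξ : ℝ) : ℂ))) =ᶠ[nhds 0]
        fun _ ↦ 0 := by
      filter_upwards [notMem_tsupport_iff_eventuallyEq.1 h0] with y hy
      rw [hy, Pi.zero_apply, zero_mul]
    rw [this.deriv_eq, deriv_const, norm_zero]
    positivity
  · have h1 : HasDerivAt (disp μ) (deriv (disp μ) ξ) ξ :=
      ((contDiffAt_disp hμ hξ).differentiableAt (by simp)).hasDerivAt
    have h2 := (h1.const_mul t).cexp_I_mul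
    have h3 : HasDerivAt β (deriv β ξ) ξ := (hβ.differentiable (by simp) ξ).hasDerivAt
    have hexp : ‖Complex.exp (Complex.I * ((t * disp μ ξ : ℝ) : ℂ))‖ = 1 := by
      rw [mul_comm, Complex.norm_exp_ofReal_mul_I]
    have h4 : HasDerivAt (fun ξ ↦ β ξ * Complex.exp (Complex.I * ((t * disp μ ξ : ℝ) : ℂ))) _ ξ :=
      h3.mul h2
    rw [h4.deriv]
    refine (norm_add_le _ _).trans ?_
    rw [norm_mul, norm_mul, norm_mul, norm_mul, hexp, Complex.norm_I, Complex.norm_real, mul_one,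
      one_mul, one_mul, Real.norm_eq_abs, abs_mul, abs_of_nonneg ht, mul_comm ‖β ξ‖]
    gcongr
    exact mul_le_of_le_one_right ht (abs_deriv_disp_le_one hμ hξ)

/-- Wave packets spread like `√t` in `L¹`. -/
theorem exists_schwartz_wave_packet {β : ℝ → ℂ} (hβ : ContDiff ℝ (⊤ : ℕ∞) β)
    (hβc : HasCompactSupport β) (h0 : (0 : ℝ) ∉ tsupport β) : ∃ M : ℝ, 0 < M ∧
    ∀ μ : ℝ, 0 < μ → ∀ t : ℝ, 1 ≤ t → ∃ s : 𝓢(ℝ, ℂ),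
      (∀ ξ, s ξ = β ξ * Complex.exp (Complex.I * ((t * disp μ ξ : ℝ) : ℂ))) ∧
      ∫ v, ‖(𝓕⁻ s : 𝓢(ℝ, ℂ)) v‖ ≤ M * √t := by
  have hβ1 : Continuous (deriv β) := hβ.continuous_deriv (by simp)
  have hi : Integrable fun ξ ↦ (‖deriv β ξ‖ + ‖β ξ‖) ^ 2 := by
    refine Continuous.integrable_of_hasCompactSupport (by have := hβ.continuous; fun_prop) ?_
    refine hβc.mono' fun ξ hξ ↦ ?_
    by_contra h
    refine hξ ?_
    have h1 : deriv β ξ = 0 := by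
      by_contra h2
      exact h (support_deriv_subset h2)
    have h2 : β ξ = 0 := image_eq_zero_of_notMem_tsupport h
    simp [h1, h2]
  set A := ∫ ξ, (‖deriv β ξ‖ + ‖β ξ‖) ^ 2 with hA
  have hA0 : 0 ≤ A := by positivity
  -- M involves β only: μ enters through the phase, whose derivative is at most t in absolute value.
  refine ⟨(Real.pi + 2 * A) / 2, by positivity, fun μ hμ t ht ↦ ?_⟩
  have ht0 : 0 < t := by linarith
  have hst : 0 < √t := Real.sqrt_pos.2 ht0
  set s : 𝓢(ℝ, ℂ) := HasCompactSupport.toSchwartzMap (hβc.mul_right)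
    (contDiff_mul_cexp_disp hμ t hβ h0) with hs
  have hsv : ∀ ξ, s ξ = β ξ * Complex.exp (Complex.I * ((t * disp μ ξ : ℝ) : ℂ)) :=
    fun ξ ↦ rfl
  have hexp : ∀ ξ, ‖Complex.exp (Complex.I * ((t * disp μ ξ : ℝ) : ℂ))‖ = 1 := fun ξ ↦ by
    rw [mul_comm, Complex.norm_exp_ofReal_mul_I]
  -- With κ = t√t both contributions are of order √t, since the squared L² norms of s and s' are at
  -- most A and t²A; the latter uses t ≥ 1.
  refine ⟨s, hsv, (integral_norm_fourierInv_le s ht0 (by positivity : 0 < t * √t)).trans ?_⟩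
  have h1 : ∫ x, ‖s x‖ ^ 2 ≤ A := by
    refine integral_mono s.integrable_norm_sq hi fun ξ ↦ ?_
    simp only [hsv]
    rw [norm_mul, hexp, mul_one]
    gcongr
    linarith [norm_nonneg (deriv β ξ)]
  have h2 : ∫ x, ‖deriv s x‖ ^ 2 ≤ t ^ 2 * A := by
    rw [hA, ← integral_const_mul]
    refine integral_mono (SchwartzMap.derivCLM ℂ ℂ s).integrable_norm_sq (hi.const_mul _)
      fun ξ ↦ ?_
    simp only
    rw [← mul_pow]
    gcongr
    refine (norm_deriv_mul_cexp_disp_le hμ ht0.le hβ h0 ξ).trans ?_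
    nlinarith [norm_nonneg (deriv β ξ)]
  have h3 : (t ^ 2 * (∫ x, ‖s x‖ ^ 2) + ∫ x, ‖deriv s x‖ ^ 2) / (t * √t) ≤ 2 * A * √t := by
    rw [div_le_iff₀ (by positivity)]
    have : 2 * A * √t * (t * √t) = t ^ 2 * A + t ^ 2 * A := by
      have : √t * √t = t := Real.mul_self_sqrt ht0.le
      linear_combination (2 * A * t) * this
    rw [this]
    gcongr
  have h4 : t * √t / t = √t := by field_simp
  rw [h4]
  linarith

/-! ### The lower bound by duality. -/

theorem zetaR_eq_fourier (μ : ℝ) (P₀ : ℝ → ℂ) (t v : ℝ) :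
    zetaR μ P₀ t (-(2 * Real.pi) * v) = -(Complex.I * t / 2) * 𝓕 (zetaIntegrand μ P₀ t 0) v := by
  rw [zetaR, Real.fourier_eq']
  congr 2
  ext ξ
  simp only [zetaIntegrand, smul_eq_mul, Complex.ofReal_zero, mul_zero, zero_mul, Complex.exp_zero,
    mul_one]
  rw [mul_comm]
  congr 2
  simp
  ring

/-- Hölder's inequality; a nonzero dilation preserves null sets, so the essential supremum survives
the rescaling, here by -2π to match the two Fourier normalisations. -/
theorem enorm_integral_comp_mul_mul_le {ζ r : ℝ → ℂ} {a : ℝ} (ha : a ≠ 0)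
    (hr : AEStronglyMeasurable r volume) :
    ‖∫ v, ζ (a * v) * r v‖ₑ ≤ eLpNorm ζ ∞ volume * ∫⁻ v, ‖r v‖ₑ := by
  have hq : Measure.QuasiMeasurePreserving (fun v : ℝ ↦ a * v) volume volume := by
    refine ⟨measurable_const_mul a, ?_⟩
    rw [Real.map_volume_mul_left ha]
    exact Measure.smul_absolutelyContinuous
  have h1 : ∀ᵐ X, ‖ζ X‖ₑ ≤ eLpNorm ζ ∞ volume := by
    rw [eLpNorm_exponent_top]
    exact enorm_ae_le_eLpNormEssSup ζ volume
  refine (enorm_integral_le_lintegral_enorm _).trans ?_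
  rw [← lintegral_const_mul'' _ hr.enorm]
  refine lintegral_mono_ae ?_
  filter_upwards [hq.ae h1] with v hv
  rw [enorm_mul]
  gcongr

theorem exists_le_norm_integral_disp_mul_hat {P₀ : ℝ → ℂ} (hP : Integrable P₀) {ξ₀ : ℝ}
    (hξ₀ : ξ₀ ≠ 0) (h : hat P₀ ξ₀ ≠ 0) (μmax : ℝ) :
    ∃ β : ℝ → ℂ, ContDiff ℝ (⊤ : ℕ∞) β ∧ HasCompactSupport β ∧ (0 : ℝ) ∉ tsupport β ∧ ∃ c : ℝ, 0 < c ∧ ∀ μ : ℝ, 0 < μ → μ ≤ μmax →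
      c ≤ ‖∫ ξ, (disp μ ξ : ℂ) * hat P₀ ξ * β ξ‖ := by
  set α := hat P₀ ξ₀ with hα
  have hc := continuous_hat hP
  have hα0 : 0 < ‖α‖ ^ 2 := by positivity
  have hre : Continuous fun ξ ↦ ((starRingEnd ℂ) α * hat P₀ ξ).re :=
    Complex.continuous_re.comp (continuous_const.mul hc)
  have hval : ((starRingEnd ℂ) α * hat P₀ ξ₀).re = ‖α‖ ^ 2 := by
    rw [← hα, mul_comm, Complex.mul_conj, Complex.ofReal_re, Complex.normSq_eq_norm_sq]
  have hev : ∀ᶠ ξ in nhds ξ₀, ‖α‖ ^ 2 / 2 < ((starRingEnd ℂ) α * hat P₀ ξ).re := by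
    refine hre.continuousAt.eventually_const_lt ?_
    simp only [hval]
    linarith
  obtain ⟨δ, hδ, hball⟩ := Metric.eventually_nhds_iff.1 hev
  -- The second entry keeps the support of the bump away from 0.
  set d := min δ (|ξ₀| / 2) with hd
  have hd0 : 0 < d := lt_min hδ (by positivity)
  let b : ContDiffBump ξ₀ := ⟨d / 2, d, by positivity, by linarith⟩
  have hsupp : ∀ ξ, b ξ ≠ 0 → dist ξ ξ₀ < d := fun ξ hξ ↦ by
    have : ξ ∈ Function.support b := hξ
    rw [b.support_eq] at this
    exact this
  have hlow : ∀ ξ, dist ξ ξ₀ < d → |ξ₀| / 2 ≤ |ξ| ∧ |ξ| ≤ 2 * |ξ₀| := fun ξ hξ ↦ by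
    have h1 : |ξ - ξ₀| < |ξ₀| / 2 := by
      rw [← Real.dist_eq]
      exact hξ.trans_le (min_le_right _ _)
    have h2 := abs_sub_abs_le_abs_sub ξ ξ₀
    have h3 := abs_sub_abs_le_abs_sub ξ₀ ξ
    rw [abs_sub_comm] at h3
    constructor <;> linarith [abs_nonneg ξ₀]
  -- The conjugate of α aligns the argument of the transform of P₀ near ξ₀, and the factor ξ makes
  -- ξ·`disp μ ξ` = ξ² ω(√μ ξ) nonnegative whatever the sign of ξ₀.
  set β : ℝ → ℂ := fun ξ ↦ (starRingEnd ℂ) α * ((ξ * b ξ : ℝ) : ℂ) with hβ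
  have hβs : ContDiff ℝ (⊤ : ℕ∞) β :=
    contDiff_const.mul (Complex.ofRealCLM.contDiff.comp (contDiff_id.mul b.contDiff))
  have hβt : tsupport β ⊆ tsupport b := by
    refine closure_mono fun ξ hξ hb ↦ hξ ?_
    simp [hβ, hb]
  refine ⟨β, hβs, b.hasCompactSupport.mono' fun ξ hξ ↦ hβt (subset_closure hξ), fun h0 ↦ ?_, ?_⟩
  · have := hβt h0
    rw [b.tsupport_eq, Metric.mem_closedBall, Real.dist_eq, zero_sub, abs_neg] at this
    have h1 : d ≤ |ξ₀| / 2 := min_le_right _ _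
    have h2 : |ξ₀| ≤ d := this
    have := abs_pos.2 hξ₀
    linarith
  have hbint : Integrable b := b.continuous.integrable_of_hasCompactSupport b.hasCompactSupport
  -- Lower bound of ξ² ω(√μ ξ) on the support of the bump, where |ξ₀|/2 ≤ |ξ| ≤ 2|ξ₀|, using ω(x) ≥
  -- 1/(1+|x|); uniform for μ ≤ μmax.
  set κ := (|ξ₀| / 2) ^ 2 * (1 / (1 + √μmax * (2 * |ξ₀|))) with hκ
  have hκ0 : 0 < κ := by
    have := abs_pos.2 hξ₀
    positivity
  refine ⟨κ * (‖α‖ ^ 2 / 2) * ∫ ξ, b ξ, by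
    have := b.integral_pos (μ := volume)
    positivity, fun μ hμ hμm ↦ ?_⟩
  have hfi : Integrable fun ξ ↦ (disp μ ξ : ℂ) * hat P₀ ξ * β ξ := by
    have hm : AEStronglyMeasurable (fun ξ ↦ (disp μ ξ : ℂ) * hat P₀ ξ * β ξ) volume := by
      refine (AEStronglyMeasurable.mul ?_ hc.aestronglyMeasurable).mul
        hβs.continuous.aestronglyMeasurable
      exact (Complex.measurable_ofReal.comp (measurable_disp μ)).aestronglyMeasurable
    have hi : Integrable fun ξ : ℝ ↦ |ξ| * ‖hat P₀ ξ‖ * ‖β ξ‖ := by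
      have := hβs.continuous
      refine Continuous.integrable_of_hasCompactSupport (by fun_prop) ?_
      refine b.hasCompactSupport.mono' fun ξ hξ ↦ hβt (subset_closure fun h0 ↦ hξ ?_)
      simp [h0]
    refine hi.mono' hm (Eventually.of_forall fun ξ ↦ ?_)
    rw [norm_mul, norm_mul, Complex.norm_real, Real.norm_eq_abs]
    exact mul_le_mul_of_nonneg_right (mul_le_mul_of_nonneg_right (abs_disp_le_self hμ ξ)
      (norm_nonneg _)) (norm_nonneg _)
  refine le_trans ?_ (Complex.re_le_norm _)
  rw [← integral_const_mul]
  change _ ≤ RCLike.re (∫ ξ, (disp μ ξ : ℂ) * hat P₀ ξ * β ξ)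
  rw [← integral_re hfi]
  refine integral_mono (hbint.const_mul _) hfi.re fun ξ ↦ ?_
  have e : RCLike.re ((disp μ ξ : ℂ) * hat P₀ ξ * β ξ) =
      ξ ^ 2 * waveOmega (√μ * ξ) * b ξ * ((starRingEnd ℂ) α * hat P₀ ξ).re := by
    rw [hβ, show (disp μ ξ : ℂ) * hat P₀ ξ * ((starRingEnd ℂ) α * ((ξ * b ξ : ℝ) : ℂ)) =
      ((disp μ ξ * (ξ * b ξ) : ℝ) : ℂ) * ((starRingEnd ℂ) α * hat P₀ ξ) by push_cast; ring]
    change (((disp μ ξ * (ξ * b ξ) : ℝ) : ℂ) * ((starRingEnd ℂ) α * hat P₀ ξ)).re = _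
    rw [Complex.re_ofReal_mul, disp]
    ring
  simp only
  rw [e]
  by_cases hb : b ξ = 0
  · simp [hb]
  · have hdist := hsupp ξ hb
    have h1 := (hball (hdist.trans_le (min_le_left _ _))).le
    obtain ⟨h2, h3⟩ := hlow ξ hdist
    have h4 : κ ≤ ξ ^ 2 * waveOmega (√μ * ξ) := by
      rw [hκ, ← sq_abs ξ]
      refine mul_le_mul (by gcongr) ?_ (by positivity) (by positivity)
      refine le_trans ?_ (one_div_one_add_abs_le_waveOmega _)
      rw [abs_mul, abs_of_nonneg (Real.sqrt_nonneg μ)]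
      gcongr
    have h5 : 0 ≤ b ξ := b.nonneg
    calc κ * (‖α‖ ^ 2 / 2) * b ξ = κ * b ξ * (‖α‖ ^ 2 / 2) := by ring
      _ ≤ ξ ^ 2 * waveOmega (√μ * ξ) * b ξ * ((starRingEnd ℂ) α * hat P₀ ξ).re :=
        mul_le_mul (mul_le_mul_of_nonneg_right h4 h5) h1 (by positivity)
          (mul_nonneg (hκ0.le.trans h4) h5)

theorem exists_amplification_lower_bound {P₀ : ℝ → ℂ} (hP : Integrable P₀)
    (h : ¬ P₀ =ᵐ[volume] 0) (μmax : ℝ)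
    (hint : ∀ μ : ℝ, 0 < μ → μ ≤ μmax → ∀ t : ℝ, 0 ≤ t →
      Integrable (zetaIntegrand μ P₀ t 0) volume) :
    ∃ c : ℝ, 0 < c ∧ ∀ μ : ℝ, 0 < μ → μ ≤ μmax → ∀ t : ℝ, 1 ≤ t → ENNReal.ofReal c ≤
      eLpNorm (fun X : ℝ ↦ ((1 / Real.sqrt t : ℝ) : ℂ) * zetaR μ P₀ t X) ∞ volume := by
  obtain ⟨ξ₀, hξ₀, hne⟩ := exists_hat_ne_zero hP h
  obtain ⟨β, hβ, hβc, hβ0, c, hc, hlow⟩ := exists_le_norm_integral_disp_mul_hat hP hξ₀ hne μmax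
  obtain ⟨M, hM, hpack⟩ := exists_schwartz_wave_packet hβ hβc hβ0
  -- The pairing is at least tc/2 and the packet has L¹ norm at most M√t; dividing also by √t leaves
  -- c/(2M).
  refine ⟨c / (2 * M), by positivity, fun μ hμ hμm t ht ↦ ?_⟩
  have ht0 : 0 < t := by linarith
  have hst : 0 < √t := Real.sqrt_pos.2 ht0
  obtain ⟨s, hs, hsM⟩ := hpack μ hμ t ht
  set r : 𝓢(ℝ, ℂ) := 𝓕⁻ s with hr
  have h1 : ∫ v, zetaR μ P₀ t (-(2 * Real.pi) * v) * r v =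
      -(Complex.I * t / 2) * ∫ ξ, (disp μ ξ : ℂ) * hat P₀ ξ * β ξ := by
    simp_rw [zetaR_eq_fourier, mul_assoc]
    rw [integral_const_mul,
      integral_fourier_mul_eq_of_integrable (hint μ hμ hμm t ht0.le) r.integrable]
    congr 2
    ext ξ
    rw [← SchwartzMap.fourier_coe, hr, FourierTransform.fourier_fourierInv_eq, hs, zetaIntegrand]
    have e : Complex.exp (-(Complex.I * t * disp μ ξ)) *
        Complex.exp (Complex.I * ((t * disp μ ξ : ℝ) : ℂ)) = 1 := by
      rw [← Complex.exp_add, ← Complex.exp_zero]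
      congr 1
      push_cast
      ring
    rw [Complex.ofReal_zero, mul_zero, zero_mul, Complex.exp_zero]
    linear_combination (disp μ ξ * hat P₀ ξ * β ξ) * e
  have h2 := enorm_integral_comp_mul_mul_le (ζ := zetaR μ P₀ t) (r := r)
    (a := -(2 * Real.pi)) (neg_ne_zero.2 (by have := Real.pi_pos; positivity))
    r.continuous.aestronglyMeasurable
  have h3 : ENNReal.ofReal (t / 2 * c) ≤ ‖∫ v, zetaR μ P₀ t (-(2 * Real.pi) * v) * r v‖ₑ := by
    rw [h1, ← ofReal_norm, norm_mul]
    refine ENNReal.ofReal_le_ofReal ?_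
    have : ‖-(Complex.I * t / 2)‖ = t / 2 := by simp [abs_of_pos ht0]
    rw [this]
    gcongr
    exact hlow μ hμ hμm
  have h4 : ∫⁻ v, ‖r v‖ₑ ≤ ENNReal.ofReal (M * √t) := by
    rw [← ofReal_integral_norm_eq_lintegral_enorm r.integrable]
    exact ENNReal.ofReal_le_ofReal hsM
  have h5 := h3.trans (h2.trans (mul_le_mul' le_rfl h4))
  have h6 : eLpNorm (fun X : ℝ ↦ ((1 / Real.sqrt t : ℝ) : ℂ) * zetaR μ P₀ t X) ∞ volume =
      ENNReal.ofReal (1 / √t) * eLpNorm (zetaR μ P₀ t) ∞ volume := by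
    have : (fun X : ℝ ↦ ((1 / Real.sqrt t : ℝ) : ℂ) * zetaR μ P₀ t X) =
      ((1 / Real.sqrt t : ℝ) : ℂ) • zetaR μ P₀ t := rfl
    rw [this, eLpNorm_const_smul, ← ofReal_norm, Complex.norm_real,
      Real.norm_of_nonneg (by positivity)]
  rw [h6]
  have h7 : ENNReal.ofReal (c / (2 * M)) =
      ENNReal.ofReal (1 / (M * t)) * ENNReal.ofReal (t / 2 * c) := by
    rw [← ENNReal.ofReal_mul (by positivity)]
    congr 1
    field_simp
  have h8 : ENNReal.ofReal (1 / (M * t)) * ENNReal.ofReal (M * √t) = ENNReal.ofReal (1 / √t) := by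
    rw [← ENNReal.ofReal_mul (by positivity)]
    congr 1
    have : √t ^ 2 = t := Real.sq_sqrt ht0.le
    field_simp
    exact this
  rw [h7, ← h8, mul_assoc, mul_comm (ENNReal.ofReal (M * √t))]
  exact mul_le_mul' le_rfl h5

theorem mainTheorem8 (μmax : ℝ) (hμmax : 0 < μmax) :
    ∃ C : ℝ, 0 < C ∧ ∀ P₀ : ℝ → ℂ,
      MemH 3 P₀ → MemW 2 1 P₀ → MemH 3 (fun X : ℝ ↦ (X : ℂ) * P₀ X) →
      (∀ μ : ℝ, 0 < μ → μ ≤ μmax → ∀ t : ℝ, 0 ≤ t →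
        (∀ X : ℝ, Integrable (zetaIntegrand μ P₀ t X) volume ∧
          zetaR μ P₀ t X =
            ∫ ξ : ℝ, rightGoingHat μ (resonantPressureHat μ P₀) t ξ *
              Complex.exp (Complex.I * X * ξ)) ∧
        eLpNorm (zetaR μ P₀ t) ∞ volume ≤
          ENNReal.ofReal (C * Real.sqrt (t / μ)) *
            (hNorm 3 P₀ + eLpNorm P₀ 1 volume + hNorm 3 (fun X : ℝ ↦ (X : ℂ) * P₀ X))) ∧
      (¬ P₀ =ᵐ[volume] 0 → ∃ c : ℝ, 0 < c ∧ ∀ μ : ℝ, 0 < μ → μ ≤ μmax →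
        ENNReal.ofReal c ≤
          liminf (fun t : ℝ ↦
            eLpNorm (fun X : ℝ ↦ ((1 / Real.sqrt t : ℝ) : ℂ) * zetaR μ P₀ t X) ∞ volume)
            atTop) := by
  obtain ⟨C, hC, H⟩ := exists_amplification_upper_bound μmax
  refine ⟨C, hC, fun P₀ hP hW hXP ↦ ⟨fun μ hμ hμm t ht ↦ ?_, fun hne ↦ ?_⟩⟩
  · obtain ⟨h1, h2⟩ := H P₀ hP hW hXP μ hμ hμm t ht
    exact ⟨fun X ↦ ⟨h1 X, zetaR_eq_integral_rightGoingHat μ P₀ t X⟩, h2⟩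
  · obtain ⟨c, hc, hlow⟩ := exists_amplification_lower_bound (memLp_one_iff_integrable.1 hW.1) hne
      μmax fun μ hμ hμm t ht ↦ (H P₀ hP hW hXP μ hμ hμm t ht).1 0
    -- The bound holds for every t ≥ 1, hence passes to the lower limit.
    refine ⟨c, hc, fun μ hμ hμm ↦ le_liminf_of_le (by isBoundedDefault) ?_⟩
    filter_upwards [eventually_ge_atTop 1] with t ht using hlow μ hμ hμm t ht
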